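/- Let $d\ge 0$ be an integer and $[m]=\{1,\dots,m\}$. **Partition labeled trees.** An ordered partition of $[d+1]$ is a tuple $\mathcal S=(S_1,\dots,S_k)$ of pairwise disjoint nonempty sets with union $[d+1]$. A plane rooted tree (the subtrees at each vertex are linearly ordered) is strictly branching if each internal (i.e. non-leaf) vertex has at least two children; trees are considered up to isomorphism. $\mathscr P_d$ is the set of pairs $(\mathcal S,\mathrm T)$ where $\mathcal S=(S_1,\dots,S_k)$ is an ordered partition of $[d+1]$ and $\mathrm T$ is a strictly branching plane rooted tree with $k$ leaves $\ell_1,\dots,\ell_k$ (from left to right); $S_a$ is regarded as the label of $\ell_a$. **Kapranov poset.** Write $(\mathcal S_1,\mathrm T_1)\lessdot_{KP}(\mathcal S_2,\mathrm T_2)$ if either (i) $\mathcal S_1=\mathcal S_2$ and $\mathrm T_2$ is obtained from $\mathrm T_1$ by contracting a single edge between two internal vertices; or (ii) $\mathrm T_1$ has an internal vertex $p$ all of whose children are leaves, $\mathrm T_2$ is obtained from $\mathrm T_1$ by contracting all edges between $p$ and its children, and $\mathcal S_2$ is obtained from $\mathcal S_1$ by labeling the resulting new leaf with the union of the labels of the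 children of $p$ and keeping all other labels. Let $\le_{KP}$ be the reflexive-transitive closure of $\lessdot_{KP}$ on $\mathscr P_d$; it is a partial order, and the Kapranov poset is $\mathscr P_d$ with this order and an added minimum $\hat 0$. **Cones.** Let $W_d=\mathbb R^{d+1}/\mathbb R(1,\dots,1)$. For a permutation $\pi$ of $[d+1]$ and $1\le i\le d$ put $\mathrm D^\pi_i w=w_{\pi^{-1}(i+1)}-w_{\pi^{-1}(i)}$ for $w\in W_d$. Let $(\mathcal S,\mathrm T)\in\mathscr P_d$, $\mathcal S=(S_1,\dots,S_k)$, $t_i=|S_1|+\dots+|S_i|$. For $1\le i\le k-1$, let $v_i$ be the closest common ancestor of $\ell_i$ and $\ell_{i+1}$ in $\mathrm T$. Define a preorder on $\{t_1,\dots,t_{k-1}\}$ by: $t_i\preceq_{(\mathcal S,\mathrm T)}t_j$ if and only if $v_j=v_i$ or $v_j$ is an ancestor of $v_i$. Choose $\pi$ such that $(\{\pi^{-1}(1)\},\dots,\{\pi^{-1}(d+1)\})$ refines $\mathcal S$, i.e. such that the index of the block of $\mathcal S$ containing $\pi^{-1}(a)$ is weakly increasing in $a$, and let $\sigma(\mathcal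 S,\mathrm T)$ be the set of all $w\in W_d$ such that - $w_x=w_y$ whenever $x,y$ lie in the same block of $\mathcal S$, - $\mathrm D^\pi_i w\le \mathrm D^\pi_j w$ whenever $i\preceq_{(\mathcal S,\mathrm T)}j$, - $\mathrm D^\pi_\ell w\ge 0$ whenever $\ell$ is a minimal element of $\preceq_{(\mathcal S,\mathrm T)}$; this does not depend on the choice of $\pi$. Let $\Xi_d=\{\sigma(\mathcal S,\mathrm T):(\mathcal S,\mathrm T)\in\mathscr P_d\}$. A face of a polyhedron $P\subseteq W_d$ is the empty set or a set of the form $\{x\in P: f(x)\ge f(y)\text{ for all }y\in P\}$ for a linear functional $f$ on $W_d$. **Proposition.** The map $(\mathcal S,\mathrm T)\mapsto\sigma(\mathcal S,\mathrm T)$ is a bijection from $\mathscr P_d$ onto $\Xi_d$. Moreover, for all $(\mathcal S_1,\mathrm T_1),(\mathcal S_2,\mathrm T_2)\in\mathscr P_d$, we have $(\mathcal S_1,\mathrm T_1)\le_{KP}(\mathcal S_2,\mathrm T_2)$ in the Kapranov poset if and only if $\sigma(\mathcal S_2,\mathrm T_2)$ is a face of $\sigma(\mathcal S_1,\mathrm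 T_1)$. -/

import Mathlib

namespace PermutoAssoc

/-! ### Plane rooted trees -/

/-- Unlabeled plane rooted trees: a vertex with the linearly ordered list of the subtrees rooted
at its children. -/
inductive PlaneTree : Type
  | node : List PlaneTree → PlaneTree

namespace PlaneTree

/-- The tree on one vertex. A vertex without children is a leaf; all other vertices are internal. -/
def leaf : PlaneTree := node []

/-- Every internal vertex has at least two children. -/
inductive StrictlyBranching : PlaneTree → Prop
  | leaf : StrictlyBranching leaf
  | node (cs : List PlaneTree) (two_le : 2 ≤ cs.length)
      (children : ∀ c ∈ cs, StrictlyBranching c) : StrictlyBranching (node cs)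

/-! A vertex of a tree is addressed by the path from the root to it: the list of the (zero-based)
positions, among its siblings, of each vertex that follows the root on this path. In particular
`u` is an ancestor of `v` (or `u = v`) if and only if `u` is a prefix of `v`. -/

mutual
/-- The addresses of the leaves of a tree, from left to right. -/
def leafPaths : PlaneTree → List (List ℕ)
  | node [] => [[]]
  | node (c :: cs) => forestLeafPaths 0 (c :: cs)
/-- The addresses of the leaves of a list of sibling trees, the first of which is at position
`p` among its siblings. -/
def forestLeafPaths : ℕ → List PlaneTree → List (List ℕ)
  | _, [] => []
  | p, t :: ts => (leafPaths t).map (fun v => p :: v) ++ forestLeafPaths (p + 1) ts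
end

/-- The number of leaves. -/
def numLeaves (T : PlaneTree) : ℕ := T.leafPaths.length

mutual
/-- The number of internal vertices. -/
def numInternal : PlaneTree → ℕ
  | node [] => 0
  | node (c :: cs) => 1 + forestNumInternal (c :: cs)
/-- The number of internal vertices of a list of trees. -/
def forestNumInternal : List PlaneTree → ℕ
  | [] => 0
  | t :: ts => numInternal t + forestNumInternal ts
end

/-- The closest common ancestor of two vertices: the longest common prefix of the addresses. -/
def commonAncestor : List ℕ → List ℕ → List ℕ
  | a :: u, b :: v => if a = b then a :: commonAncestor u v else []
  | _, _ => []

/-- The `i`-th leaf `ℓ_i` from the left, `1 ≤ i ≤ numLeaves`. -/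
def leafAt (T : PlaneTree) (i : ℕ) : List ℕ := T.leafPaths.getD (i - 1) []

/-- The internal vertex that carries the label `i`, for `1 ≤ i < numLeaves`: the closest common
ancestor of the leaves `ℓ_i` and `ℓ_{i+1}`. -/
def labeledVertex (T : PlaneTree) (i : ℕ) : List ℕ :=
  commonAncestor (T.leafAt i) (T.leafAt (i + 1))

/-- `ContractEdge T T'`: the tree `T'` is obtained from `T` by contracting a single internal edge.
The children of the lower end of the edge take its place in the list of children of
the upper end. -/
inductive ContractEdge : PlaneTree → PlaneTree → Prop
  | root (l r cs : List PlaneTree) (internal : cs ≠ []) :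
      ContractEdge (node (l ++ node cs :: r)) (node (l ++ cs ++ r))
  | child (l r : List PlaneTree) {t t' : PlaneTree} (h : ContractEdge t t') :
      ContractEdge (node (l ++ t :: r)) (node (l ++ t' :: r))

/-- `CollapseVertex T a m T'`: the tree `T` has an internal vertex all of whose children are leaves;
these are the `m` leaves `ℓ_{a+1}, …, ℓ_{a+m}` of `T`; and `T'` is obtained from `T` by
contracting all the edges between this vertex and its children, so that it becomes a leaf. -/
inductive CollapseVertex : PlaneTree → ℕ → ℕ → PlaneTree → Prop
  | root (m : ℕ) (internal : m ≠ 0) : CollapseVertex (node (List.replicate m leaf)) 0 m leaf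
  | child (l r : List PlaneTree) {t t' : PlaneTree} {a m : ℕ} (h : CollapseVertex t a m t') :
      CollapseVertex (node (l ++ t :: r)) ((l.map numLeaves).sum + a) m (node (l ++ t' :: r))

theorem forestNumInternal_append (l r : List PlaneTree) :
    forestNumInternal (l ++ r) = forestNumInternal l + forestNumInternal r := by
  induction l with
  | nil => simp [forestNumInternal]
  | cons t l ih => simp [forestNumInternal, ih, add_assoc]

theorem numInternal_node {l : List PlaneTree} (h : l ≠ []) :
    numInternal (node l) = 1 + forestNumInternal l := by
  cases l with
  | nil => exact absurd rfl h
  | cons c cs => simp [numInternal]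

theorem ContractEdge.numInternal_lt {T T' : PlaneTree} (h : ContractEdge T T') :
    T'.numInternal < T.numInternal := by
  induction h with
  | root l r cs hcs =>
    have h' : l ++ cs ++ r ≠ [] := by simp [hcs]
    rw [numInternal_node h', numInternal_node (by simp)]
    simp only [forestNumInternal_append, forestNumInternal, numInternal_node hcs]
    omega
  | child l r h ih =>
    rw [numInternal_node (by simp), numInternal_node (by simp)]
    simp only [forestNumInternal_append, forestNumInternal]
    omega

theorem CollapseVertex.numInternal_lt {T T' : PlaneTree} {a m : ℕ} (h : CollapseVertex T a m T') :
    T'.numInternal < T.numInternal := by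
  induction h with
  | root m hm =>
    rw [numInternal_node (by simpa using hm)]
    simp [leaf, numInternal]
  | child l r h ih =>
    rw [numInternal_node (by simp), numInternal_node (by simp)]
    simp only [forestNumInternal_append, forestNumInternal]
    omega

end PlaneTree

/-! ### Ordered set partitions -/

/-- Ordered set partitions of an `n`-element set: a list of disjoint nonempty blocks whose union is
the whole set. -/
structure OrderedPartition (n : ℕ) where
  blocks : List (Finset (Fin n))
  nonempty : ∀ B ∈ blocks, B.Nonempty
  disjoint : blocks.Pairwise Disjoint
  cover : ∀ x, ∃ B ∈ blocks, x ∈ B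

namespace OrderedPartition

variable {n : ℕ}

/-- The preorder of an ordered partition: `x ∈ S_a` and `y ∈ S_b` with `a ≤ b`. -/
def Le (S : OrderedPartition n) (x y : Fin n) : Prop :=
  ∃ a b : Fin S.blocks.length, a ≤ b ∧ x ∈ S.blocks.get a ∧ y ∈ S.blocks.get b

/-- The equivalence relation of the preorder: `x` and `y` are in the same block. -/
def Equiv (S : OrderedPartition n) (x y : Fin n) : Prop := S.Le x y ∧ S.Le y x

/-- `S` refines `S'`: each block of `S` lies in a block of `S'`, compatibly with the orders of the
blocks. -/
def Refines (S S' : OrderedPartition n) : Prop :=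
  ∃ f : Fin S.blocks.length → Fin S'.blocks.length,
    Monotone f ∧ ∀ a, S.blocks.get a ⊆ S'.blocks.get (f a)

/-- The ordered partition `({π⁻¹(1)}, …, {π⁻¹(n)})` into singletons. -/
def ofPerm (π : Equiv.Perm (Fin n)) : OrderedPartition n where
  blocks := List.ofFn fun a => {π.symm a}
  nonempty := by simp [List.mem_ofFn]
  disjoint := by
    rw [List.pairwise_ofFn]
    intro i j hij
    simpa using hij.ne
  cover := fun x => ⟨{x}, by simpa [List.mem_ofFn] using π.symm.surjective x, by simp⟩

/-- `t_i = |S_1| + ⋯ + |S_i|`. The type of `S = (S_1, …, S_k)` is `(t_1, …, t_{k-1})`. -/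
def typeAt (S : OrderedPartition n) (i : ℕ) : ℕ := ((S.blocks.take i).map Finset.card).sum

theorem existsUnique_index (S : OrderedPartition n) (x : Fin n) :
    ∃! a : Fin S.blocks.length, x ∈ S.blocks.get a := by
  obtain ⟨B, hB, hx⟩ := S.cover x
  obtain ⟨a, ha, rfl⟩ := List.getElem_of_mem hB
  refine ⟨⟨a, ha⟩, hx, ?_⟩
  rintro ⟨b, hb⟩ hxb
  have hp := List.pairwise_iff_getElem.1 S.disjoint
  rcases lt_trichotomy a b with h | h | h
  · exact absurd hxb (Finset.disjoint_left.1 (hp a b ha hb h) hx)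
  · simp [h]
  · exact absurd hx (Finset.disjoint_left.1 (hp b a hb ha h) hxb)

theorem exists_index (S : OrderedPartition n) :
    ∃ f : Fin n → Fin S.blocks.length, ∀ x a, x ∈ S.blocks.get a ↔ f x = a := by
  choose f hf hu using S.existsUnique_index
  exact ⟨f, fun x a => ⟨fun h => (hu x a h).symm, fun h => h ▸ hf x⟩⟩

theorem refines_ofPerm_iff (S : OrderedPartition n) {f : Fin n → Fin S.blocks.length}
    (hf : ∀ x a, x ∈ S.blocks.get a ↔ f x = a) (π : Equiv.Perm (Fin n)) :
    (ofPerm π).Refines S ↔ Monotone (f ∘ π.symm) := by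
  have hl : (ofPerm π).blocks.length = n := by simp [ofPerm]
  constructor
  · rintro ⟨g, hg, h⟩
    have key : f ∘ π.symm = g ∘ Fin.cast hl.symm := by
      funext a
      have h₁ := h (Fin.cast hl.symm a)
      simp only [ofPerm, List.get_ofFn, Finset.singleton_subset_iff] at h₁
      exact (hf _ _).1 h₁
    rw [key]
    exact fun a b hab => hg (a := Fin.cast hl.symm a) (b := Fin.cast hl.symm b) hab
  · intro h
    refine ⟨fun a => f (π.symm (Fin.cast hl a)),
      fun a b hab => h (a := Fin.cast hl a) (b := Fin.cast hl b) hab, fun a => ?_⟩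
    have h₁ : (ofPerm π).blocks.get a = {π.symm (Fin.cast hl a)} :=
      List.get_ofFn _ _
    rw [h₁, Finset.singleton_subset_iff]
    exact (hf _ _).2 rfl

/-- Every ordered partition has a refinement into singletons. -/
theorem exists_refines (S : OrderedPartition n) :
    ∃ π : Equiv.Perm (Fin n), (ofPerm π).Refines S := by
  obtain ⟨f, hf⟩ := S.exists_index
  refine ⟨(Tuple.sort f).symm, (S.refines_ofPerm_iff hf _).2 ?_⟩
  simpa using Tuple.monotone_sort f

end OrderedPartition

/-! ### Partition labeled trees and the Kapranov poset -/

/-- `[d+1]`-partition labeled trees: a strictly branching plane rooted tree with `k` leaves, and an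
ordered partition of `[d+1]` into `k` blocks, which label the leaves from left to right. (The number
of leaves is then at most `d + 1`, because the blocks are nonempty.) -/
structure PartitionLabeledTree (d : ℕ) where
  part : OrderedPartition (d + 1)
  tree : PlaneTree
  branching : tree.StrictlyBranching
  length_eq : part.blocks.length = tree.numLeaves

namespace PartitionLabeledTree

variable {d : ℕ}

/-- The relation `⋖_KP`: either an internal edge is contracted and the partition is kept, or a
minimal internal vertex, whose children are the leaves `ℓ_{a+1}, …, ℓ_{a+m}`, becomes a
leaf labeled by the union of the blocks `S_{a+1}, …, S_{a+m}`. -/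
inductive Step (P Q : PartitionLabeledTree d) : Prop
  | contract (hpart : P.part = Q.part) (htree : P.tree.ContractEdge Q.tree)
  | collapse (a m : ℕ) (htree : P.tree.CollapseVertex a m Q.tree)
      (hpart : Q.part.blocks = P.part.blocks.take a ++
        ((P.part.blocks.drop a).take m).foldr (· ∪ ·) ∅ :: P.part.blocks.drop (a + m))

theorem Step.numInternal_lt {P Q : PartitionLabeledTree d} (h : Step P Q) :
    Q.tree.numInternal < P.tree.numInternal := by
  cases h with
  | contract _ h => exact h.numInternal_lt
  | collapse a m h _ => exact h.numInternal_lt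

theorem eq_or_lt_of_reflTransGen {P Q : PartitionLabeledTree d}
    (h : Relation.ReflTransGen Step P Q) :
    P = Q ∨ Q.tree.numInternal < P.tree.numInternal := by
  induction h with
  | refl => exact Or.inl rfl
  | tail _ hs ih =>
    have := hs.numInternal_lt
    rcases ih with rfl | ih
    · exact Or.inr this
    · exact Or.inr (this.trans ih)

/-- The partial order `≤_KP`, generated by `⋖_KP`. -/
instance : PartialOrder (PartitionLabeledTree d) where
  le := Relation.ReflTransGen Step
  le_refl _ := Relation.ReflTransGen.refl
  le_trans _ _ _ := Relation.ReflTransGen.trans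
  le_antisymm P Q h₁ h₂ := by
    rcases eq_or_lt_of_reflTransGen h₁ with h | h
    · exact h
    · rcases eq_or_lt_of_reflTransGen h₂ with h' | h'
      · exact h'.symm
      · exact absurd h h'.asymm

end PartitionLabeledTree

/-- The Kapranov poset: the partition labeled trees with a minimum `0̂` added. -/
abbrev KapranovPoset (d : ℕ) : Type := WithBot (PartitionLabeledTree d)

/-! ### The cones -/

/-- The space `W_d`, the quotient of `ℝ^{d+1}` by the line spanned by `(1, …, 1)`. -/
abbrev W (d : ℕ) : Type :=
  (Fin (d + 1) → ℝ) ⧸ Submodule.span ℝ {(1 : Fin (d + 1) → ℝ)}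

/-- The linear functional `w ↦ w_x - w_y` on `W_d`. -/
def coordDiff {d : ℕ} (x y : Fin (d + 1)) : W d →ₗ[ℝ] ℝ :=
  (Submodule.span ℝ {(1 : Fin (d + 1) → ℝ)}).liftQ
    (LinearMap.proj (R := ℝ) (φ := fun _ => ℝ) x - LinearMap.proj (R := ℝ) (φ := fun _ => ℝ) y)
    (by simp [Submodule.span_singleton_le_iff_mem])

/-- `D^π_{i+1} w = w_{π⁻¹(i+2)} - w_{π⁻¹(i+1)}` with one-based indices, for `0 ≤ i < d`. -/
def D {d : ℕ} (π : Equiv.Perm (Fin (d + 1))) (i : Fin d) : W d →ₗ[ℝ] ℝ :=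
  coordDiff (π.symm i.succ) (π.symm i.castSucc)

/-- The subspace `W_S` of all `w` with `w_x = w_y` whenever `x` and `y` are in one block of `S`. -/
def WS {d : ℕ} (S : OrderedPartition (d + 1)) : Set (W d) :=
  {w | ∀ x y, S.Equiv x y → coordDiff x y w = 0}

/-- If `S(π)` and `S(π')` both refine `S`, then `D^π` and `D^π'` agree on `W_S`. -/
theorem D_eq_of_refines {d : ℕ} {S : OrderedPartition (d + 1)} {π π' : Equiv.Perm (Fin (d + 1))}
    (h : (OrderedPartition.ofPerm π).Refines S) (h' : (OrderedPartition.ofPerm π').Refines S)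
    {w : W d} (hw : w ∈ WS S) (i : Fin d) : D π i w = D π' i w := by
  obtain ⟨f, hf⟩ := S.exists_index
  have key := Tuple.unique_monotone ((S.refines_ofPerm_iff hf π).1 h)
    ((S.refines_ofPerm_iff hf π').1 h')
  have hle : ∀ x y, f x = f y → S.Le x y := fun x y hxy =>
    ⟨f x, f y, hxy.le, (hf _ _).2 rfl, (hf _ _).2 rfl⟩
  have hz : ∀ a, coordDiff (π.symm a) (π'.symm a) w = 0 := fun a =>
    hw _ _ ⟨hle _ _ (congrFun key a), hle _ _ (congrFun key a).symm⟩
  have h₁ := hz i.succ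
  have h₂ := hz i.castSucc
  induction w using Submodule.Quotient.induction_on with
  | H v =>
    simp only [D, coordDiff, Submodule.liftQ_apply, LinearMap.sub_apply, LinearMap.proj_apply]
      at h₁ h₂ ⊢
    linarith

namespace PartitionLabeledTree

variable {d : ℕ}

/-- The preorder `⪯_{(S,T)}` on the type `{t_1, …, t_{k-1}}` of `S`: `t_i ⪯ t_j` if the internal
vertex of `T` labeled `j` is an ancestor of (or equal to) the one labeled `i`. -/
def Prec (P : PartitionLabeledTree d) (p q : ℕ) : Prop :=
  ∃ i j : ℕ, (1 ≤ i ∧ i < P.tree.numLeaves) ∧ (1 ≤ j ∧ j < P.tree.numLeaves) ∧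
    p = P.part.typeAt i ∧ q = P.part.typeAt j ∧
    P.tree.labeledVertex j <+: P.tree.labeledVertex i

/-- `l` is a minimal element of the preorder `⪯_{(S,T)}` on the type of `S`. -/
def IsMinimalLabel (P : PartitionLabeledTree d) (l : ℕ) : Prop :=
  (∃ i : ℕ, 1 ≤ i ∧ i < P.tree.numLeaves ∧ l = P.part.typeAt i) ∧ ∀ m, P.Prec m l → P.Prec l m

/-- The set that defines `σ(S,T)`, written with the permutation `π`. -/
def coneWith (P : PartitionLabeledTree d) (π : Equiv.Perm (Fin (d + 1))) : Set (W d) :=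
  {w | w ∈ WS P.part ∧
    (∀ i j : Fin d, P.Prec (i + 1) (j + 1) → D π i w ≤ D π j w) ∧
    ∀ l : Fin d, P.IsMinimalLabel (l + 1) → 0 ≤ D π l w}

/-- The cone `σ(S,T)`: choose `π` such that `S(π)` refines `S`. -/
noncomputable def cone (P : PartitionLabeledTree d) : Set (W d) :=
  P.coneWith P.part.exists_refines.choose

/-- The cone `σ(S,T)` does not depend on the choice of `π`. -/
theorem cone_eq (P : PartitionLabeledTree d) {π : Equiv.Perm (Fin (d + 1))}
    (h : (OrderedPartition.ofPerm π).Refines P.part) : P.cone = P.coneWith π := by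
  ext w
  have hD := fun hw i => D_eq_of_refines P.part.exists_refines.choose_spec h (w := w) hw i
  constructor
  · rintro ⟨hw, h₁, h₂⟩
    exact ⟨hw, fun i j hij => hD hw i ▸ hD hw j ▸ h₁ i j hij, fun l hl => hD hw l ▸ h₂ l hl⟩
  · rintro ⟨hw, h₁, h₂⟩
    exact ⟨hw, fun i j hij => (hD hw i).symm ▸ (hD hw j).symm ▸ h₁ i j hij,
      fun l hl => (hD hw l).symm ▸ h₂ l hl⟩

end PartitionLabeledTree

/-- The collection `Ξ_d` of all the cones `σ(S,T)`. -/
def Xi (d : ℕ) : Set (Set (W d)) := {C | ∃ P : PartitionLabeledTree d, C = P.cone}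

/-- `F` is a face of the polyhedron `C`: the set of the points of `C` where some linear functional is
maximal on `C`, or (by convention) the empty set. -/
def IsFace {d : ℕ} (C F : Set (W d)) : Prop :=
  F = ∅ ∨ ∃ l : W d →ₗ[ℝ] ℝ, F = {x | x ∈ C ∧ ∀ y ∈ C, l y ≤ l x}

end PermutoAssoc

/-!
A point `w` of `W_S` is determined by the list of the gaps between its values on consecutive blocks
of `S`, that is, by one real number for each pair of neighbouring leaves of `T`. It lies in `σ(S,T)`
if and only if the gaps with the same closest common ancestor agree, and the gaps are nonnegative
and increase towards the root.

If one of these inequalities between an internal vertex and its parent becomes an equality, the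
edge between them can be contracted. If the gap at a vertex whose children are all leaves becomes
zero, the labels of these leaves can be merged. So every point of `σ(S,T)` can be pushed up in the
Kapranov poset to a cone where all the inequalities are strict. Conversely, a list of gaps that is
strictly monotone for some tree determines the tree: the largest gaps separate the subtrees of the
children of the root. As strict gaps are positive, `w` also determines `S`. Hence the sets of strict
points are disjoint, `σ(S₂,T₂) ⊆ σ(S₁,T₁)` implies `(S₁,T₁) ≤ (S₂,T₂)`, and `σ` is injective.

Each step of the Kapranov poset cuts out of a cone the zero set of a linear functional that is
nonnegative on it, which gives an extreme subset. Extreme subsets compose, and a nonempty convex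
extreme subset of a polyhedron is a face.
-/

namespace PermutoAssoc

/-! ### Monotone lists of gaps -/

namespace PlaneTree

theorem induction_on_children {p : PlaneTree → Prop} (T : PlaneTree)
    (node : ∀ cs : List PlaneTree, (∀ c ∈ cs, p c) → p (node cs)) : p T :=
  PlaneTree.rec (motive_1 := p) (motive_2 := fun cs => ∀ c ∈ cs, p c) node (by simp)
    (fun _ _ hc hcs => List.forall_mem_cons.2 ⟨hc, hcs⟩) T

theorem length_forestLeafPaths (p : ℕ) (cs : List PlaneTree) :
    (forestLeafPaths p cs).length = (cs.map numLeaves).sum := by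
  induction cs generalizing p with
  | nil => simp [forestLeafPaths]
  | cons c cs ih => simp [forestLeafPaths, ih, numLeaves]

theorem numLeaves_leaf : leaf.numLeaves = 1 := by simp [leaf, numLeaves, leafPaths]

theorem numLeaves_node {cs : List PlaneTree} (h : cs ≠ []) :
    (node cs).numLeaves = (cs.map numLeaves).sum := by
  obtain ⟨c, cs, rfl⟩ := List.exists_cons_of_ne_nil h
  rw [numLeaves, leafPaths, length_forestLeafPaths]

theorem StrictlyBranching.of_mem {cs : List PlaneTree} (h : (PlaneTree.node cs).StrictlyBranching)
    {c : PlaneTree} (hc : c ∈ cs) : c.StrictlyBranching := by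
  cases h with
  | leaf => simp at hc
  | node _ _ h => exact h c hc

theorem StrictlyBranching.two_le_length {cs : List PlaneTree}
    (h : (PlaneTree.node cs).StrictlyBranching) (hcs : cs ≠ []) : 2 ≤ cs.length := by
  cases h with
  | leaf => exact absurd rfl hcs
  | node _ h _ => exact h

theorem StrictlyBranching.replace_child {l s : List PlaneTree} {t t' : PlaneTree}
    (h : (PlaneTree.node (l ++ t :: s)).StrictlyBranching) (ht' : t'.StrictlyBranching) :
    (PlaneTree.node (l ++ t' :: s)).StrictlyBranching := by
  refine .node _ (by simpa using h.two_le_length (by simp)) fun c hc => ?_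
  obtain hc | rfl | hc : c ∈ l ∨ c = t' ∨ c ∈ s := by simpa using hc
  · exact h.of_mem (by simp [hc])
  · exact ht'
  · exact h.of_mem (by simp [hc])

theorem ContractEdge.strictlyBranching {T T' : PlaneTree} (h : ContractEdge T T')
    (hT : T.StrictlyBranching) : T'.StrictlyBranching := by
  induction h with
  | root l s cs hcs =>
    have hn : (node cs).StrictlyBranching := hT.of_mem (by simp)
    refine .node _ ?_ fun c hc => ?_
    · have := hn.two_le_length hcs
      simp only [List.length_append]
      omega
    · obtain hc | hc | hc : c ∈ l ∨ c ∈ cs ∨ c ∈ s := by simpa using hc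
      · exact hT.of_mem (by simp [hc])
      · exact hn.of_mem hc
      · exact hT.of_mem (by simp [hc])
  | child l s _ ih => exact hT.replace_child (ih (hT.of_mem (by simp)))

theorem CollapseVertex.strictlyBranching {T T' : PlaneTree} {a m : ℕ}
    (h : CollapseVertex T a m T') (hT : T.StrictlyBranching) : T'.StrictlyBranching := by
  induction h with
  | root m _ => exact .leaf
  | child l s _ ih => exact hT.replace_child (ih (hT.of_mem (by simp)))

theorem CollapseVertex.two_le {T T' : PlaneTree} {a m : ℕ} (h : CollapseVertex T a m T')
    (hT : T.StrictlyBranching) : 2 ≤ m := by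
  induction h with
  | root m hm => simpa using hT.two_le_length (by simpa using hm)
  | child l s _ ih => exact ih (hT.of_mem (by simp))

theorem CollapseVertex.add_le_numLeaves {T T' : PlaneTree} {a m : ℕ}
    (h : CollapseVertex T a m T') : a + m ≤ T.numLeaves := by
  induction h with
  | root m hm => simp [numLeaves_node (show List.replicate m leaf ≠ [] by simpa), numLeaves_leaf]
  | child l s h ih =>
    rw [numLeaves_node (by simp)]
    simp only [List.map_append, List.sum_append, List.map_cons, List.sum_cons]
    omega

theorem exists_eq_append_of_append_singleton_eq {α : Type*} {x : α} {L A C : List α}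
    (h : L ++ [x] = A ++ x :: C) : ∃ D, D ++ [x] = x :: C ∧ L = A ++ D := by
  obtain ⟨D, y, hD⟩ := List.eq_nil_or_concat' (x :: C) |>.resolve_left (List.cons_ne_nil x C)
  obtain ⟨rfl, ⟨⟩⟩ : L = A ++ D ∧ [x] = [y] := List.append_inj' (by simp [h, hD]) rfl
  exact ⟨D, hD.symm, rfl⟩

section MonotoneGaps

variable {α : Type*} [Zero α]

mutual
/-- The gaps of a tree are its pairs of neighbouring leaves, from left to right, and a list `L` of
values of the gaps is *monotone* for `r` if gaps with the same closest common ancestor `v` have the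
same value `x`, if `r 0 x`, and if `r y x` for the values `y` at the descendants of `v`. -/
def MonotoneGaps (r : α → α → Prop) : PlaneTree → List α → Prop
  | node [], L => L = []
  | node (c :: cs), L => ∃ x, r 0 x ∧ ForestMonotoneGaps r x (c :: cs) (L ++ [x])
/-- The version of `MonotoneGaps` for the children of a vertex with the value `x`. To make it
additive in the list of children, each child is followed by a gap with the value `x`, including the
last one. -/
def ForestMonotoneGaps (r : α → α → Prop) (x : α) : List PlaneTree → List α → Prop
  | [], M => M = []
  | c :: cs, M => ∃ L M', M = L ++ x :: M' ∧ MonotoneGaps r c L ∧ (∀ y ∈ L, r y x) ∧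
      ForestMonotoneGaps r x cs M'
end

variable {r : α → α → Prop} {x : α}

theorem monotoneGaps_leaf {L : List α} : MonotoneGaps r leaf L ↔ L = [] := by
  rw [leaf, MonotoneGaps]

theorem monotoneGaps_node {cs : List PlaneTree} (hcs : cs ≠ []) {L : List α} :
    MonotoneGaps r (node cs) L ↔ ∃ x, r 0 x ∧ ForestMonotoneGaps r x cs (L ++ [x]) := by
  obtain ⟨c, cs, rfl⟩ := List.exists_cons_of_ne_nil hcs
  rw [MonotoneGaps]

theorem forestMonotoneGaps_nil {M : List α} : ForestMonotoneGaps r x [] M ↔ M = [] := by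
  rw [ForestMonotoneGaps]

theorem forestMonotoneGaps_cons {c : PlaneTree} {cs : List PlaneTree} {M : List α} :
    ForestMonotoneGaps r x (c :: cs) M ↔ ∃ L M', M = L ++ x :: M' ∧ MonotoneGaps r c L ∧
      (∀ y ∈ L, r y x) ∧ ForestMonotoneGaps r x cs M' := by
  rw [ForestMonotoneGaps]

theorem forestMonotoneGaps_singleton {c : PlaneTree} {L : List α} :
    ForestMonotoneGaps r x [c] (L ++ [x]) ↔ MonotoneGaps r c L ∧ ∀ y ∈ L, r y x := by
  simp [forestMonotoneGaps_cons, forestMonotoneGaps_nil]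

theorem forestMonotoneGaps_append {l s : List PlaneTree} {M : List α} :
    ForestMonotoneGaps r x (l ++ s) M ↔ ∃ M₁ M₂, M = M₁ ++ M₂ ∧ ForestMonotoneGaps r x l M₁ ∧
      ForestMonotoneGaps r x s M₂ := by
  induction l generalizing M with
  | nil => simp [forestMonotoneGaps_nil]
  | cons c l ih =>
    simp only [List.cons_append, forestMonotoneGaps_cons, ih]
    constructor
    · rintro ⟨L, _, rfl, hc, hL, M₁, M₂, rfl, h₁, h₂⟩
      exact ⟨L ++ x :: M₁, M₂, by simp, ⟨L, M₁, rfl, hc, hL, h₁⟩, h₂⟩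
    · rintro ⟨_, M₂, rfl, ⟨L, M₁, rfl, hc, hL, h₁⟩, h₂⟩
      exact ⟨L, M₁ ++ M₂, by simp, hc, hL, M₁, M₂, rfl, h₁, h₂⟩

theorem ForestMonotoneGaps.exists_eq_append_singleton {cs : List PlaneTree} {M : List α}
    (h : ForestMonotoneGaps r x cs M) (hcs : cs ≠ []) : ∃ L, M = L ++ [x] := by
  rw [← List.dropLast_append_getLast hcs, forestMonotoneGaps_append] at h
  obtain ⟨M₁, _, rfl, -, h⟩ := h
  obtain ⟨L, _, rfl, -, -, h⟩ := forestMonotoneGaps_cons.1 h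
  exact ⟨M₁ ++ L, by simp [forestMonotoneGaps_nil.1 h]⟩

mutual
theorem MonotoneGaps.length_add_one : ∀ {T : PlaneTree} {L : List α}, MonotoneGaps r T L →
    L.length + 1 = T.numLeaves
  | node [], L, h => by rw [monotoneGaps_leaf.1 h]; exact numLeaves_leaf.symm
  | node (c :: cs), L, h => by
    obtain ⟨x, -, h⟩ := (monotoneGaps_node (List.cons_ne_nil c cs)).1 h
    simpa [numLeaves_node] using h.length_eq
theorem ForestMonotoneGaps.length_eq : ∀ {cs : List PlaneTree} {x : α} {M : List α},
    ForestMonotoneGaps r x cs M → M.length = (cs.map numLeaves).sum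
  | [], x, M, h => by simp [forestMonotoneGaps_nil.1 h]
  | c :: cs, x, M, h => by
    obtain ⟨L, M', rfl, hc, -, h⟩ := forestMonotoneGaps_cons.1 h
    simp only [List.length_append, List.length_cons, List.map_cons, List.sum_cons,
      ← hc.length_add_one, ← h.length_eq]
    omega
end

mutual
theorem MonotoneGaps.zero_rel : ∀ {T : PlaneTree} {L : List α}, MonotoneGaps r T L →
    ∀ y ∈ L, r 0 y
  | node [], L, h, y, hy => by simp [monotoneGaps_leaf.1 h] at hy
  | node (c :: cs), L, h, y, hy => by
    obtain ⟨x, hx, h⟩ := (monotoneGaps_node (List.cons_ne_nil c cs)).1 h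
    exact h.zero_rel hx y (by simp [hy])
theorem ForestMonotoneGaps.zero_rel : ∀ {cs : List PlaneTree} {x : α} {M : List α},
    ForestMonotoneGaps r x cs M → r 0 x → ∀ y ∈ M, r 0 y
  | [], x, M, h, _, y, hy => by simp [forestMonotoneGaps_nil.1 h] at hy
  | c :: cs, x, M, h, hx, y, hy => by
    obtain ⟨L, M', rfl, hc, -, h⟩ := forestMonotoneGaps_cons.1 h
    obtain hy | rfl | hy : y ∈ L ∨ y = x ∨ y ∈ M' := by simpa using hy
    · exact hc.zero_rel y hy
    · exact hx
    · exact h.zero_rel hx y hy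
end

mutual
theorem MonotoneGaps.imp {s : α → α → Prop} (hrs : ∀ a b, r a b → s a b) :
    ∀ {T : PlaneTree} {L : List α}, MonotoneGaps r T L → MonotoneGaps s T L
  | node [], L, h => by rwa [MonotoneGaps] at h ⊢
  | node (c :: cs), L, h => by
    obtain ⟨x, hx, h⟩ := (monotoneGaps_node (List.cons_ne_nil c cs)).1 h
    exact (monotoneGaps_node (by simp)).2 ⟨x, hrs _ _ hx, h.imp hrs⟩
theorem ForestMonotoneGaps.imp {s : α → α → Prop} (hrs : ∀ a b, r a b → s a b) :
    ∀ {cs : List PlaneTree} {x : α} {M : List α}, ForestMonotoneGaps r x cs M →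
      ForestMonotoneGaps s x cs M
  | [], x, M, h => by rwa [ForestMonotoneGaps] at h ⊢
  | c :: cs, x, M, h => by
    obtain ⟨L, M', rfl, hc, hL, h⟩ := forestMonotoneGaps_cons.1 h
    exact forestMonotoneGaps_cons.2
      ⟨L, M', rfl, hc.imp hrs, fun y hy => hrs _ _ (hL y hy), h.imp hrs⟩
end

theorem ForestMonotoneGaps.rel_or_eq {cs : List PlaneTree} {M : List α}
    (h : ForestMonotoneGaps r x cs M) {y : α} (hy : y ∈ M) : r y x ∨ y = x := by
  induction cs generalizing M with
  | nil => simp [forestMonotoneGaps_nil.1 h] at hy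
  | cons c cs ih =>
    obtain ⟨L, M', rfl, -, hL, h⟩ := forestMonotoneGaps_cons.1 h
    obtain hy | rfl | hy : y ∈ L ∨ y = x ∨ y ∈ M' := by simpa using hy
    · exact .inl (hL y hy)
    · exact .inr rfl
    · exact ih h hy

/- The index `j` is that of the gap between the first two children. -/
theorem exists_getD_eq_parent {cs : List PlaneTree} (h : 2 ≤ cs.length) :
    ∃ j, ∀ (r : α → α → Prop) (x : α) (L : List α), ForestMonotoneGaps r x cs (L ++ [x]) →
      j < L.length ∧ L.getD j 0 = x := by
  match cs, h with
  | c :: c' :: cs, _ =>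
    refine ⟨c.numLeaves - 1, fun r x L hL => ?_⟩
    obtain ⟨L₁, M, hLM, hc, -, hM⟩ := forestMonotoneGaps_cons.1 hL
    obtain ⟨L₂, rfl⟩ := hM.exists_eq_append_singleton (by simp)
    obtain rfl : L = L₁ ++ x :: L₂ := List.append_cancel_right (bs := [x]) (by simpa using hLM)
    have hj : c.numLeaves - 1 = L₁.length := by have := hc.length_add_one; omega
    simp [hj]

theorem ForestMonotoneGaps.mem_of_two_le_length {cs : List PlaneTree} {L : List α}
    (h : ForestMonotoneGaps r x cs (L ++ [x])) (hcs : 2 ≤ cs.length) : x ∈ L := by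
  obtain ⟨j, hj⟩ := exists_getD_eq_parent (α := α) hcs
  obtain ⟨hjL, hjx⟩ := hj r x L h
  rw [← hjx, List.getD_eq_getElem _ _ hjL]
  exact List.getElem_mem hjL

theorem StrictlyBranching.eq_leaf_of_monotoneGaps_nil {T : PlaneTree} (hT : T.StrictlyBranching)
    (h : MonotoneGaps r T []) : T = PlaneTree.leaf := by
  cases hT with
  | leaf => rfl
  | node cs h₁ h₂ =>
    obtain ⟨x, -, h⟩ := (monotoneGaps_node (List.ne_nil_of_length_pos (by omega))).1 h
    exact absurd (h.mem_of_two_le_length (L := []) h₁) List.not_mem_nil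

/-- The lists `A` and `D` of values of the gaps to the left and to the right of some children of a
vertex with the value `x`, if the other children are `l` and `s`, respectively. The gaps that
separate `l` and `s` from these children are included. -/
def SiblingGaps (r : α → α → Prop) (x : α) (l s : List PlaneTree) (A D : List α) : Prop :=
  ForestMonotoneGaps r x l A ∧ ∃ C, D ++ [x] = x :: C ∧ ForestMonotoneGaps r x s C

theorem forestMonotoneGaps_append_append {l cs s : List PlaneTree} (hcs : cs ≠ []) {L : List α} :
    ForestMonotoneGaps r x (l ++ cs ++ s) (L ++ [x]) ↔ ∃ A B D, L = A ++ (B ++ D) ∧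
      SiblingGaps r x l s A D ∧ ForestMonotoneGaps r x cs (B ++ [x]) := by
  simp only [forestMonotoneGaps_append, SiblingGaps]
  constructor
  · rintro ⟨_, C, hL, ⟨A, E, rfl, hA, hE⟩, hC⟩
    obtain ⟨B, rfl⟩ := hE.exists_eq_append_singleton hcs
    obtain ⟨D, hD, rfl⟩ := exists_eq_append_of_append_singleton_eq
      (show L ++ [x] = A ++ B ++ x :: C by simp [hL])
    exact ⟨A, B, D, by simp, ⟨hA, C, hD, hC⟩, hE⟩
  · rintro ⟨A, B, D, rfl, ⟨hA, C, hD, hC⟩, hB⟩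
    exact ⟨A ++ (B ++ [x]), C, by simp [hD], ⟨A, B ++ [x], rfl, hA, hB⟩, hC⟩

theorem forestMonotoneGaps_append_cons {l s : List PlaneTree} {t : PlaneTree} {L : List α} :
    ForestMonotoneGaps r x (l ++ t :: s) (L ++ [x]) ↔ ∃ A B D, L = A ++ (B ++ D) ∧
      SiblingGaps r x l s A D ∧ MonotoneGaps r t B ∧ ∀ y ∈ B, r y x := by
  simp only [List.append_cons l t s, forestMonotoneGaps_append_append (List.cons_ne_nil t []),
    forestMonotoneGaps_singleton]

end MonotoneGaps

section Degeneration

variable {α : Type*} [Zero α]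

theorem monotoneGaps_node_append_append {r : α → α → Prop} {l cs s : List PlaneTree}
    (hcs : cs ≠ []) {L : List α} :
    MonotoneGaps r (node (l ++ cs ++ s)) L ↔ ∃ x A B D, L = A ++ (B ++ D) ∧ r 0 x ∧
      SiblingGaps r x l s A D ∧ ForestMonotoneGaps r x cs (B ++ [x]) := by
  rw [monotoneGaps_node (by simp [hcs])]
  simp only [forestMonotoneGaps_append_append hcs]
  grind

theorem monotoneGaps_node_append_cons {r : α → α → Prop} {l s : List PlaneTree} {t : PlaneTree}
    {L : List α} :
    MonotoneGaps r (node (l ++ t :: s)) L ↔ ∃ x A B D, L = A ++ (B ++ D) ∧ r 0 x ∧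
      SiblingGaps r x l s A D ∧ MonotoneGaps r t B ∧ ∀ y ∈ B, r y x := by
  simp only [List.append_cons l t s, monotoneGaps_node_append_append (List.cons_ne_nil t []),
    forestMonotoneGaps_singleton]

theorem getD_append_append (A B D : List α) {i : ℕ} (hi : i < B.length) :
    (A ++ (B ++ D)).getD (A.length + i) 0 = B.getD i 0 := by
  rw [List.getD_append_right _ _ _ _ (Nat.le_add_right _ _), Nat.add_sub_cancel_left,
    List.getD_append _ _ _ _ hi]

theorem exists_gaps_contract_root [Preorder α] {l cs s : List PlaneTree} (hcs : 2 ≤ cs.length)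
    (hls : 2 ≤ (l ++ node cs :: s).length) :
    ∃ i j, ∀ L : List α,
      (MonotoneGaps (· ≤ ·) (node (l ++ node cs :: s)) L →
        i < L.length ∧ j < L.length ∧ L.getD i 0 ≤ L.getD j 0) ∧
      (MonotoneGaps (· ≤ ·) (node (l ++ cs ++ s)) L ↔
        MonotoneGaps (· ≤ ·) (node (l ++ node cs :: s)) L ∧ L.getD i 0 = L.getD j 0) := by
  have hne : cs ≠ [] := List.ne_nil_of_length_pos (by omega)
  -- The lower vertex of the edge has the value of the gap `i`, the upper one that of `j`.
  obtain ⟨i, hi⟩ := exists_getD_eq_parent (α := α) hcs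
  obtain ⟨j, hj⟩ := exists_getD_eq_parent (α := α) hls
  have hgaps {x y : α} {A B D : List α} (hAD : SiblingGaps (· ≤ ·) x l s A D) (hy : 0 ≤ y)
      (hB : ForestMonotoneGaps (· ≤ ·) y cs (B ++ [y])) (hBx : ∀ b ∈ B, b ≤ x) :
      ((l.map numLeaves).sum + i < (A ++ (B ++ D)).length ∧
        (A ++ (B ++ D)).getD ((l.map numLeaves).sum + i) 0 = y) ∧
      j < (A ++ (B ++ D)).length ∧ (A ++ (B ++ D)).getD j 0 = x := by
    obtain ⟨hiB, hiy⟩ := hi _ _ _ hB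
    refine ⟨⟨?_, ?_⟩, hj _ _ _ (forestMonotoneGaps_append_cons.2
      ⟨A, B, D, rfl, hAD, (monotoneGaps_node hne).2 ⟨y, hy, hB⟩, hBx⟩)⟩
    · simp only [← hAD.1.length_eq, List.length_append]
      omega
    · rw [← hAD.1.length_eq, getD_append_append A B D hiB, hiy]
  refine ⟨(l.map numLeaves).sum + i, j, fun L => ?_⟩
  rw [monotoneGaps_node_append_append hne]
  simp only [monotoneGaps_node_append_cons, monotoneGaps_node hne]
  refine ⟨?_, ?_, ?_⟩
  · rintro ⟨x, A, B, D, rfl, _, hAD, ⟨y, hy, hB⟩, hBx⟩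
    obtain ⟨⟨hi', hiy⟩, hj', hjx⟩ := hgaps hAD hy hB hBx
    refine ⟨hi', hj', ?_⟩
    rw [hiy, hjx]
    exact hBx _ (hB.mem_of_two_le_length hcs)
  · rintro ⟨x, A, B, D, rfl, hx, hAD, hB⟩
    have hBx : ∀ b ∈ B, b ≤ x := fun b hb => (hB.rel_or_eq (by simp [hb])).elim id le_of_eq
    obtain ⟨⟨-, hiy⟩, -, hjx⟩ := hgaps hAD hx hB hBx
    exact ⟨⟨x, A, B, D, rfl, hx, hAD, ⟨x, hx, hB⟩, hBx⟩, by rw [hiy, hjx]⟩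
  · rintro ⟨⟨x, A, B, D, rfl, hx, hAD, ⟨y, hy, hB⟩, hBx⟩, h⟩
    obtain ⟨⟨-, hiy⟩, -, hjx⟩ := hgaps hAD hy hB hBx
    obtain rfl : y = x := by rw [← hiy, h, hjx]
    exact ⟨y, A, B, D, rfl, hx, hAD, hB⟩

theorem ContractEdge.exists_gaps [Preorder α] {T T' : PlaneTree} (h : ContractEdge T T')
    (hT : T.StrictlyBranching) :
    ∃ i j, ∀ L : List α,
      (MonotoneGaps (· ≤ ·) T L → i < L.length ∧ j < L.length ∧ L.getD i 0 ≤ L.getD j 0) ∧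
      (MonotoneGaps (· ≤ ·) T' L ↔ MonotoneGaps (· ≤ ·) T L ∧ L.getD i 0 = L.getD j 0) := by
  induction h with
  | root l s cs hcs =>
    exact exists_gaps_contract_root ((hT.of_mem (by simp)).two_le_length hcs)
      (hT.two_le_length (by simp))
  | child l s _ ih =>
    obtain ⟨i, j, hij⟩ := ih (hT.of_mem (by simp))
    have hgaps {x : α} {A B D : List α} (hAD : SiblingGaps (· ≤ ·) x l s A D) {k : ℕ}
        (hk : k < B.length) : (l.map numLeaves).sum + k < (A ++ (B ++ D)).length ∧
          (A ++ (B ++ D)).getD ((l.map numLeaves).sum + k) 0 = B.getD k 0 := by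
      rw [← hAD.1.length_eq]
      exact ⟨by simp only [List.length_append]; omega, getD_append_append A B D hk⟩
    refine ⟨(l.map numLeaves).sum + i, (l.map numLeaves).sum + j, fun L => ?_⟩
    simp only [monotoneGaps_node_append_cons]
    refine ⟨?_, ?_, ?_⟩
    · rintro ⟨x, A, B, D, rfl, -, hAD, hB, -⟩
      obtain ⟨hi, hj, h⟩ := (hij B).1 hB
      exact ⟨(hgaps hAD hi).1, (hgaps hAD hj).1, by rwa [(hgaps hAD hi).2, (hgaps hAD hj).2]⟩
    · rintro ⟨x, A, B, D, rfl, hx, hAD, hB', hBx⟩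
      obtain ⟨hB, h⟩ := (hij B).2.1 hB'
      obtain ⟨hi, hj, -⟩ := (hij B).1 hB
      exact ⟨⟨x, A, B, D, rfl, hx, hAD, hB, hBx⟩, by rw [(hgaps hAD hi).2, (hgaps hAD hj).2, h]⟩
    · rintro ⟨⟨x, A, B, D, rfl, hx, hAD, hB, hBx⟩, h⟩
      obtain ⟨hi, hj, -⟩ := (hij B).1 hB
      rw [(hgaps hAD hi).2, (hgaps hAD hj).2] at h
      exact ⟨x, A, B, D, rfl, hx, hAD, (hij B).2.2 ⟨hB, h⟩, hBx⟩

theorem forestMonotoneGaps_replicate_leaf {r : α → α → Prop} {x : α} {m : ℕ} {M : List α} :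
    ForestMonotoneGaps r x (List.replicate m leaf) M ↔ M = List.replicate m x := by
  induction m generalizing M with
  | zero => simp [forestMonotoneGaps_nil]
  | succ m ih => simp [List.replicate_succ, forestMonotoneGaps_cons, monotoneGaps_leaf, ih]

theorem CollapseVertex.monotoneGaps_append_replicate_append [Preorder α] {T T' : PlaneTree}
    {a m : ℕ} (h : CollapseVertex T a m T') {L' : List α} (hL' : MonotoneGaps (· ≤ ·) T' L') :
    ∃ A B, L' = A ++ B ∧ A.length = a ∧
      MonotoneGaps (· ≤ ·) T (A ++ (List.replicate (m - 1) 0 ++ B)) := by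
  induction h generalizing L' with
  | root m hm =>
    obtain ⟨m, rfl⟩ := Nat.exists_eq_succ_of_ne_zero hm
    refine ⟨[], [], monotoneGaps_leaf.1 hL', rfl, (monotoneGaps_node (by simp)).2 ⟨0, le_rfl,
      forestMonotoneGaps_replicate_leaf.2 (by simp [List.replicate_succ'])⟩⟩
  | child l s h ih =>
    obtain ⟨x, A, _, D, rfl, hx, hAD, hB, hBx⟩ := monotoneGaps_node_append_cons.1 hL'
    obtain ⟨B₁, B₂, rfl, rfl, hB'⟩ := ih hB
    refine ⟨A ++ B₁, B₂ ++ D, by simp, by simp [hAD.1.length_eq],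
      monotoneGaps_node_append_cons.2 ⟨x, A, _, D, by simp, hx, hAD, hB', fun y hy => ?_⟩⟩
    obtain hy | ⟨-, rfl⟩ | hy : y ∈ B₁ ∨ (_ ∧ y = 0) ∨ y ∈ B₂ := by simpa using hy
    · exact hBx y (by simp [hy])
    · exact hx
    · exact hBx y (by simp [hy])

theorem CollapseVertex.lt_length {r : α → α → Prop} {T T' : PlaneTree} {a m : ℕ}
    (h : CollapseVertex T a m T') (hT : T.StrictlyBranching) {L : List α}
    (hL : MonotoneGaps r T L) : a < L.length := by
  have := h.add_le_numLeaves
  have := h.two_le hT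
  have := hL.length_add_one
  omega

theorem CollapseVertex.exists_eq_append_replicate_append [Preorder α] {T T' : PlaneTree}
    {a m : ℕ} (h : CollapseVertex T a m T') (hT : T.StrictlyBranching) {L : List α}
    (hL : MonotoneGaps (· ≤ ·) T L) (ha : L.getD a 0 = 0) :
    ∃ A B, A.length = a ∧ L = A ++ (List.replicate (m - 1) 0 ++ B) ∧
      MonotoneGaps (· ≤ ·) T' (A ++ B) := by
  induction h generalizing L with
  | root m hm =>
    obtain ⟨x, -, h⟩ := (monotoneGaps_node (by simpa)).1 hL
    have hm₂ : 2 ≤ m := by simpa using hT.two_le_length (by simpa)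
    obtain ⟨m, rfl⟩ := Nat.exists_eq_add_of_le' hm₂
    rw [forestMonotoneGaps_replicate_leaf, List.replicate_succ', List.append_left_inj] at h
    obtain rfl : x = 0 := by simpa [h] using ha
    exact ⟨[], [], rfl, by simp [h], monotoneGaps_leaf.2 rfl⟩
  | child l s h ih =>
    obtain ⟨x, A, B, D, rfl, hx, hAD, hB, hBx⟩ := monotoneGaps_node_append_cons.1 hL
    have ht := hT.of_mem (c := _) (List.mem_append_right l List.mem_cons_self)
    rw [← hAD.1.length_eq, getD_append_append A B D (h.lt_length ht hB)] at ha
    obtain ⟨B₁, B₂, rfl, rfl, hB'⟩ := ih ht hB ha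
    refine ⟨A ++ B₁, B₂ ++ D, by simp [hAD.1.length_eq], by simp,
      monotoneGaps_node_append_cons.2 ⟨x, A, _, D, by simp, hx, hAD, hB', fun y hy => hBx y ?_⟩⟩
    simp only [List.mem_append] at hy ⊢
    tauto

theorem ForestMonotoneGaps.eq_replicate_leaf [Preorder α] {cs : List PlaneTree} {M : List α}
    (h : ForestMonotoneGaps (· < ·) 0 cs M) (hcs : ∀ c ∈ cs, c.StrictlyBranching) :
    ∃ m, cs = List.replicate m leaf := by
  induction cs generalizing M with
  | nil => exact ⟨0, rfl⟩
  | cons c cs ih =>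
    obtain ⟨L, M', -, hc, hL, hM'⟩ := forestMonotoneGaps_cons.1 h
    obtain rfl : L = [] := List.eq_nil_iff_forall_not_mem.2 fun y hy =>
      (hL y hy).not_gt (hc.zero_rel y hy)
    obtain rfl := (hcs c (by simp)).eq_leaf_of_monotoneGaps_nil hc
    obtain ⟨m, rfl⟩ := ih hM' fun c hc => hcs c (by simp [hc])
    exact ⟨m + 1, rfl⟩

theorem ForestMonotoneGaps.exists_of_not {r s : α → α → Prop} {x : α} {cs : List PlaneTree}
    {M : List α} (h : ForestMonotoneGaps r x cs M) (h' : ¬ ForestMonotoneGaps s x cs M) :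
    ∃ l t u A B C, cs = l ++ t :: u ∧ M = A ++ B ++ x :: C ∧ ForestMonotoneGaps r x l A ∧
      ForestMonotoneGaps r x u C ∧ MonotoneGaps r t B ∧ (∀ y ∈ B, r y x) ∧
      ¬ (MonotoneGaps s t B ∧ ∀ y ∈ B, s y x) := by
  induction cs generalizing M with
  | nil => exact absurd h (by rwa [forestMonotoneGaps_nil] at h' ⊢)
  | cons c cs ih =>
    obtain ⟨L, M', rfl, hc, hL, h⟩ := forestMonotoneGaps_cons.1 h
    by_cases hs : MonotoneGaps s c L ∧ ∀ y ∈ L, s y x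
    · obtain ⟨l, t, u, A, B, C, rfl, rfl, hA, hC, hB⟩ := ih h fun h₁ =>
        h' (forestMonotoneGaps_cons.2 ⟨L, M', rfl, hs.1, hs.2, h₁⟩)
      exact ⟨c :: l, t, u, L ++ x :: A, B, C, rfl, by simp,
        forestMonotoneGaps_cons.2 ⟨L, A, rfl, hc, hL, hA⟩, hC, hB⟩
    · exact ⟨[], c, cs, [], L, M', rfl, rfl, forestMonotoneGaps_nil.2 rfl, h, hc, hL, hs⟩

theorem exists_contractEdge_of_mem [PartialOrder α] {l s : List PlaneTree} {t : PlaneTree}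
    {x : α} {A B D : List α} (ht : t.StrictlyBranching) (hAD : SiblingGaps (· ≤ ·) x l s A D)
    (hB : MonotoneGaps (· < ·) t B) (hBx : ∀ y ∈ B, y ≤ x) (hx : x ∈ B) :
    ∃ T', ContractEdge (node (l ++ t :: s)) T' ∧ MonotoneGaps (· ≤ ·) T' (A ++ (B ++ D)) := by
  obtain ⟨cs⟩ := t
  have hcs : cs ≠ [] := by
    rintro rfl
    exact List.ne_nil_of_mem hx (monotoneGaps_leaf.1 hB)
  obtain ⟨y, hy, hB⟩ := (monotoneGaps_node hcs).1 hB
  obtain rfl : y = x := (hBx y (hB.mem_of_two_le_length (ht.two_le_length hcs))).antisymm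
    ((hB.rel_or_eq (List.mem_append_left _ hx)).elim le_of_lt le_of_eq)
  exact ⟨_, .root l s cs hcs, (monotoneGaps_node_append_append hcs).2
    ⟨y, A, B, D, rfl, hy.le, hAD, hB.imp fun _ _ => le_of_lt⟩⟩

theorem MonotoneGaps.lt_or_exists [PartialOrder α] {T : PlaneTree} (hT : T.StrictlyBranching)
    {L : List α} (hL : MonotoneGaps (· ≤ ·) T L) :
    MonotoneGaps (· < ·) T L ∨ (∃ T', ContractEdge T T' ∧ MonotoneGaps (· ≤ ·) T' L) ∨
      ∃ a m T', CollapseVertex T a m T' ∧ L.getD a 0 = 0 := by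
  induction T using induction_on_children generalizing L with
  | node cs ih =>
    rcases eq_or_ne cs [] with rfl | hcs
    · exact .inl (monotoneGaps_leaf.2 (monotoneGaps_leaf.1 hL))
    obtain ⟨x, hx, hM⟩ := (monotoneGaps_node hcs).1 hL
    by_cases hM' : ForestMonotoneGaps (· < ·) x cs (L ++ [x])
    · rcases hx.eq_or_lt with rfl | hx
      · obtain ⟨m, rfl⟩ := hM'.eq_replicate_leaf fun c hc => hT.of_mem hc
        have hL₀ : L.getD 0 0 = 0 := by
          rw [forestMonotoneGaps_replicate_leaf] at hM
          rcases L with - | ⟨y, L⟩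
          · rfl
          · exact List.eq_of_mem_replicate (hM ▸ by simp : y ∈ List.replicate m (0 : α))
        exact .inr (.inr ⟨0, m, leaf, .root m (by simpa using hcs), hL₀⟩)
      · exact .inl ((monotoneGaps_node hcs).2 ⟨x, hx, hM'⟩)
    · obtain ⟨l, t, s, A, B, C, rfl, hLM, hA, hC, hB, hBx, hnot⟩ := hM.exists_of_not hM'
      obtain ⟨D, hD, rfl⟩ := exists_eq_append_of_append_singleton_eq hLM
      have hAD : SiblingGaps (· ≤ ·) x l s A D := ⟨hA, C, hD, hC⟩
      have ht : t.StrictlyBranching := hT.of_mem (by simp)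
      rcases ih t (by simp) ht hB with hB' | ⟨t', htt', hB'⟩ | ⟨a, m, t', htt', ha⟩
      · refine .inr (.inl (List.append_assoc A B D ▸
          exists_contractEdge_of_mem ht hAD hB' hBx ?_))
        by_contra hxB
        exact hnot ⟨hB', fun y hy => (hBx y hy).lt_of_ne fun h => hxB (h ▸ hy)⟩
      · exact .inr (.inl ⟨_, .child l s htt', monotoneGaps_node_append_cons.2
          ⟨x, A, B, D, by simp, hx, hAD, hB', hBx⟩⟩)
      · refine .inr (.inr ⟨_, m, _, .child l s htt', ?_⟩)
        rw [← hA.length_eq, List.append_assoc, getD_append_append A B D (htt'.lt_length ht hB), ha]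

theorem eq_and_eq_of_append_cons_eq {β : Type*} {x : β} {L N L' N' : List β} (hL : x ∉ L)
    (hL' : x ∉ L') (h : L ++ x :: N = L' ++ x :: N') : L = L' ∧ N = N' := by
  induction L generalizing L' with
  | nil => cases L' <;> grind
  | cons y L ih => cases L' <;> grind

mutual
theorem MonotoneGaps.unique [PartialOrder α] : ∀ {T T' : PlaneTree} {L : List α},
    T.StrictlyBranching → T'.StrictlyBranching → MonotoneGaps (· < ·) T L →
      MonotoneGaps (· < ·) T' L → T = T'
  | node [], T', L, _, hT', h, h' => by
    obtain rfl := monotoneGaps_leaf.1 h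
    exact (hT'.eq_leaf_of_monotoneGaps_nil h').symm
  | node (c :: cs), node [], L, hT, _, h, h' => by
    obtain rfl := monotoneGaps_leaf.1 h'
    exact hT.eq_leaf_of_monotoneGaps_nil h
  | node (c :: cs), node (c' :: cs'), L, hT, hT', h, h' => by
    obtain ⟨x, -, h⟩ := (monotoneGaps_node (List.cons_ne_nil c cs)).1 h
    obtain ⟨x', -, h'⟩ := (monotoneGaps_node (List.cons_ne_nil c' cs')).1 h'
    have hx := h.mem_of_two_le_length (hT.two_le_length (by simp))
    have hx' := h'.mem_of_two_le_length (hT'.two_le_length (by simp))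
    obtain rfl : x = x' := le_antisymm
      ((h'.rel_or_eq (List.mem_append_left _ hx)).elim le_of_lt le_of_eq)
      ((h.rel_or_eq (List.mem_append_left _ hx')).elim le_of_lt le_of_eq)
    rw [h.unique (fun c hc => hT.of_mem hc) (fun c hc => hT'.of_mem hc) h']
theorem ForestMonotoneGaps.unique [PartialOrder α] : ∀ {cs cs' : List PlaneTree} {x : α}
    {M : List α}, (∀ c ∈ cs, c.StrictlyBranching) → (∀ c ∈ cs', c.StrictlyBranching) →
      ForestMonotoneGaps (· < ·) x cs M → ForestMonotoneGaps (· < ·) x cs' M → cs = cs'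
  | [], [], _, _, _, _, _, _ => rfl
  | [], c' :: cs', x, M, _, _, h, h' => by
    obtain ⟨L, M', rfl, -⟩ := forestMonotoneGaps_cons.1 h'
    simp [forestMonotoneGaps_nil] at h
  | c :: cs, [], x, M, _, _, h, h' => by
    obtain ⟨L, M', rfl, -⟩ := forestMonotoneGaps_cons.1 h
    simp [forestMonotoneGaps_nil] at h'
  | c :: cs, c' :: cs', x, M, hcs, hcs', h, h' => by
    obtain ⟨L, N, rfl, hc, hL, h⟩ := forestMonotoneGaps_cons.1 h
    obtain ⟨L', N', hM, hc', hL', h'⟩ := forestMonotoneGaps_cons.1 h'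
    obtain ⟨rfl, rfl⟩ := eq_and_eq_of_append_cons_eq (fun hx => (hL x hx).false)
      (fun hx => (hL' x hx).false) hM
    rw [List.forall_mem_cons] at hcs hcs'
    rw [hc.unique hcs.1 hcs'.1 hc', h.unique hcs.2 hcs'.2 h']
end

theorem ForestMonotoneGaps.exists_lt [LinearOrder α] {cs : List PlaneTree}
    (hcs : ∀ c ∈ cs, ∃ L : List α, MonotoneGaps (· < ·) c L) :
    ∃ b : α, ∀ x, b < x → ∃ M, ForestMonotoneGaps (· < ·) x cs M := by
  induction cs with
  | nil => exact ⟨0, fun x _ => ⟨[], forestMonotoneGaps_nil.2 rfl⟩⟩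
  | cons c cs ih =>
    rw [List.forall_mem_cons] at hcs
    obtain ⟨L, hL⟩ := hcs.1
    obtain ⟨b, hb⟩ := ih hcs.2
    obtain ⟨b', hb'⟩ := L.toFinset.bddAbove
    refine ⟨max b b', fun x hx => ?_⟩
    obtain ⟨M, hM⟩ := hb x ((le_max_left _ _).trans_lt hx)
    exact ⟨L ++ x :: M, forestMonotoneGaps_cons.2 ⟨L, M, rfl, hL, fun y hy =>
      (hb' (by simpa using hy)).trans_lt ((le_max_right _ _).trans_lt hx), hM⟩⟩

theorem exists_monotoneGaps_lt [LinearOrder α] [NoMaxOrder α] (T : PlaneTree) :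
    ∃ L : List α, MonotoneGaps (· < ·) T L := by
  induction T using induction_on_children with
  | node cs ih =>
    rcases eq_or_ne cs [] with rfl | hcs
    · exact ⟨[], monotoneGaps_leaf.2 rfl⟩
    · obtain ⟨b, hb⟩ := ForestMonotoneGaps.exists_lt ih
      obtain ⟨x, hx⟩ := exists_gt (max b 0)
      obtain ⟨M, hM⟩ := hb x ((le_max_left _ _).trans_lt hx)
      obtain ⟨L, rfl⟩ := hM.exists_eq_append_singleton hcs
      exact ⟨L, (monotoneGaps_node hcs).2 ⟨x, (le_max_right _ _).trans_lt hx, hM⟩⟩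

end Degeneration

/-! ### Monotone lists and closest common ancestors -/

theorem leafPaths_ne_nil (T : PlaneTree) : T.leafPaths ≠ [] := by
  induction T using induction_on_children with
  | node cs ih =>
    rcases cs with - | ⟨c, cs⟩
    · simp [leafPaths]
    · simp [leafPaths, forestLeafPaths, ih c]

theorem exists_eq_cons_of_mem_forestLeafPaths {p : ℕ} {cs : List PlaneTree} {u : List ℕ}
    (hu : u ∈ forestLeafPaths p cs) : ∃ q v, p ≤ q ∧ u = q :: v := by
  induction cs generalizing p with
  | nil => simp [forestLeafPaths] at hu
  | cons c cs ih =>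
    rw [forestLeafPaths, List.mem_append, List.mem_map] at hu
    obtain ⟨v, -, rfl⟩ | hu := hu
    · exact ⟨p, v, le_rfl, rfl⟩
    · obtain ⟨q, v, hq, rfl⟩ := ih hu
      exact ⟨q, v, by omega, rfl⟩

theorem commonAncestor_prefix (u v : List ℕ) : commonAncestor u v <+: u := by
  induction u generalizing v with
  | nil => simp [commonAncestor]
  | cons a u ih =>
    rcases v with - | ⟨b, v⟩
    · simp [commonAncestor]
    · rw [commonAncestor]
      split_ifs
      · simpa using ih v
      · simp

/-- The closest common ancestors of the neighbouring vertices of a list of vertices. -/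
def neighbourAncestors (P : List (List ℕ)) : List (List ℕ) := P.zipWith commonAncestor P.tail

theorem neighbourAncestors_append {P Q : List (List ℕ)} (hP : P ≠ []) (hQ : Q ≠ []) :
    neighbourAncestors (P ++ Q) = neighbourAncestors P ++
      commonAncestor (P.getLast hP) (Q.head hQ) :: neighbourAncestors Q := by
  obtain ⟨v, Q, rfl⟩ := List.exists_cons_of_ne_nil hQ
  induction P with
  | nil => exact absurd rfl hP
  | cons u P ih =>
    rcases P with - | ⟨u', P⟩
    · simp [neighbourAncestors]
    · simpa [neighbourAncestors] using ih (by simp)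

theorem neighbourAncestors_map_cons (p : ℕ) (P : List (List ℕ)) :
    neighbourAncestors (P.map (p :: ·)) = (neighbourAncestors P).map (p :: ·) := by
  simp [neighbourAncestors, ← List.map_tail, List.zipWith_map, List.map_zipWith, commonAncestor]

theorem length_neighbourAncestors (P : List (List ℕ)) :
    (neighbourAncestors P).length = P.length - 1 := by
  simp [neighbourAncestors]

theorem length_neighbourAncestors_leafPaths (T : PlaneTree) :
    (neighbourAncestors T.leafPaths).length + 1 = T.numLeaves := by
  have := List.length_pos_iff.2 T.leafPaths_ne_nil
  rw [length_neighbourAncestors, numLeaves]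
  omega

theorem labeledVertex_add_one (T : PlaneTree) {i : ℕ}
    (hi : i < (neighbourAncestors T.leafPaths).length) :
    T.labeledVertex (i + 1) = (neighbourAncestors T.leafPaths)[i] := by
  rw [length_neighbourAncestors] at hi
  simp only [labeledVertex, leafAt, neighbourAncestors, List.getElem_zipWith, List.getElem_tail,
    Nat.add_sub_cancel]
  rw [List.getD_eq_getElem, List.getD_eq_getElem]

theorem neighbourAncestors_append_nil {P : List (List ℕ)} (hP : P ≠ []) :
    neighbourAncestors (P ++ [[]]) = neighbourAncestors P ++ [[]] := by
  rw [neighbourAncestors_append hP (by simp)]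
  cases P.getLast hP <;> simp [neighbourAncestors, commonAncestor]

/- The root `[]` is appended for the gap that follows the last child. -/
theorem neighbourAncestors_forestLeafPaths_cons (p : ℕ) (c : PlaneTree) (cs : List PlaneTree) :
    neighbourAncestors (forestLeafPaths p (c :: cs) ++ [[]]) =
      (neighbourAncestors c.leafPaths).map (p :: ·) ++
        [] :: neighbourAncestors (forestLeafPaths (p + 1) cs ++ [[]]) := by
  have hc : c.leafPaths.map (p :: ·) ≠ [] := by simpa using c.leafPaths_ne_nil
  rw [forestLeafPaths, List.append_assoc, neighbourAncestors_append hc (by simp),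
    neighbourAncestors_map_cons, List.getLast_map]
  congr 2
  cases h : forestLeafPaths (p + 1) cs with
  | nil => simp [commonAncestor]
  | cons u _ =>
    obtain ⟨q, v, hq, rfl⟩ := exists_eq_cons_of_mem_forestLeafPaths (h ▸ List.mem_cons_self)
    simp [commonAncestor, show p ≠ q by omega]

theorem head_ne_of_mem_neighbourAncestors {p q : ℕ} {cs : List PlaneTree} {u : List ℕ}
    (hu : q :: u ∈ neighbourAncestors (forestLeafPaths (p + 1) cs ++ [[]])) : p ≠ q := by
  obtain ⟨i, hi, h⟩ := List.getElem_of_mem hu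
  rw [length_neighbourAncestors, List.length_append, List.length_singleton] at hi
  simp only [neighbourAncestors, List.getElem_zipWith] at h
  have := h ▸ commonAncestor_prefix _ _
  rw [List.getElem_append_left hi] at this
  obtain ⟨q', v, hq, hv⟩ := exists_eq_cons_of_mem_forestLeafPaths (List.getElem_mem hi)
  rw [hv, List.cons_prefix_cons] at this
  omega

theorem nil_mem_neighbourAncestors {cs : List PlaneTree} (hcs : 2 ≤ cs.length) (p : ℕ) :
    [] ∈ neighbourAncestors (forestLeafPaths p cs) := by
  match cs, hcs with
  | c :: c' :: cs, _ =>
    have hF (q : ℕ) (c : PlaneTree) (cs : List PlaneTree) : forestLeafPaths q (c :: cs) ≠ [] := by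
      simp [forestLeafPaths, c.leafPaths_ne_nil]
    have h := neighbourAncestors_forestLeafPaths_cons p c (c' :: cs)
    rw [neighbourAncestors_append_nil (hF _ _ _), neighbourAncestors_append_nil (hF _ _ _),
      ← List.cons_append, ← List.append_assoc, List.append_left_inj] at h
    simp [h]

section AncestorMonotone

variable {α : Type*} [Zero α]

/-- A list of pairs of a vertex and a value is *ancestor monotone* if the values are nonnegative
and increase towards the root. -/
def AncestorMonotone [LE α] (E : List (List ℕ × α)) : Prop :=
  (∀ e ∈ E, 0 ≤ e.2) ∧ ∀ e ∈ E, ∀ e' ∈ E, e'.1 <+: e.1 → e.2 ≤ e'.2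

theorem AncestorMonotone.subset [LE α] {E E' : List (List ℕ × α)} (h : AncestorMonotone E')
    (hE : E ⊆ E') : AncestorMonotone E :=
  ⟨fun e he => h.1 e (hE he), fun e he e' he' => h.2 e (hE he) e' (hE he')⟩

theorem ancestorMonotone_append_root [Preorder α] {p : ℕ} {x : α} {E E' : List (List ℕ × α)}
    (hE' : ∀ q u y, (q :: u, y) ∈ E' → p ≠ q) :
    AncestorMonotone (E.map (fun e => (p :: e.1, e.2)) ++ ([], x) :: E') ↔
      AncestorMonotone E ∧ (∀ e ∈ E, e.2 ≤ x) ∧ AncestorMonotone (([], x) :: E') := by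
  constructor
  · intro h
    refine ⟨⟨fun e he => ?_, fun e he e' he' hee' => ?_⟩, fun e he => ?_, h.subset (by simp)⟩
    · exact h.1 (p :: e.1, e.2) (by simp [he])
    · exact h.2 (p :: e.1, e.2) (by simp [he]) (p :: e'.1, e'.2) (by simp [he']) (by simpa)
    · exact h.2 (p :: e.1, e.2) (by simp [he]) ([], x) (by simp) (by simp)
  · rintro ⟨h, hx, h'⟩
    simp only [AncestorMonotone, List.forall_mem_append, List.forall_mem_map]
    refine ⟨⟨h.1, h'.1⟩, fun e he => ⟨fun e' he' hee' => ?_, fun e' he' hee' => ?_⟩,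
      fun e he => ⟨fun e' _ hee' => ?_, h'.2 e he⟩⟩
    · exact h.2 e he e' he' (by simpa using hee')
    · obtain ⟨_ | ⟨q, u⟩, y⟩ := e'
      · exact (hx e he).trans (h'.2 ([], x) (by simp) _ he' (by simp))
      · simp only [List.cons_prefix_cons] at hee'
        exact absurd hee'.1.symm (hE' q u y (by simpa using he'))
    · obtain ⟨_ | ⟨q, u⟩, y⟩ := e
      · simp at hee'
      · simp only [List.cons_prefix_cons] at hee'
        exact absurd hee'.1 (hE' q u y (by simpa using he))

end AncestorMonotone

section LabeledVertex

variable {α : Type*} [Zero α] [PartialOrder α]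

theorem forestMonotoneGaps_le_cons_iff {c : PlaneTree} {cs : List PlaneTree} {p : ℕ} {x : α}
    {M : List α}
    (hc : ∀ L : List α, MonotoneGaps (· ≤ ·) c L ↔ L.length + 1 = c.numLeaves ∧
      AncestorMonotone ((neighbourAncestors c.leafPaths).zip L))
    (hcs : ∀ M : List α, 0 ≤ x ∧ ForestMonotoneGaps (· ≤ ·) x cs M ↔
      M.length = (cs.map numLeaves).sum ∧ AncestorMonotone
        (([], x) :: (neighbourAncestors (forestLeafPaths (p + 1) cs ++ [[]])).zip M)) :
    0 ≤ x ∧ ForestMonotoneGaps (· ≤ ·) x (c :: cs) M ↔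
      M.length = ((c :: cs).map numLeaves).sum ∧ AncestorMonotone
        (([], x) :: (neighbourAncestors (forestLeafPaths p (c :: cs) ++ [[]])).zip M) := by
  have hG := length_neighbourAncestors_leafPaths c
  have hG' q u := head_ne_of_mem_neighbourAncestors (p := p) (q := q) (cs := cs) (u := u)
  rw [neighbourAncestors_forestLeafPaths_cons, forestMonotoneGaps_cons]
  set G := neighbourAncestors c.leafPaths
  set G' := neighbourAncestors (forestLeafPaths (p + 1) cs ++ [[]])
  have hsplit (L M' : List α) (y : α) (hL : L.length + 1 = c.numLeaves) :
      (G.map (p :: ·) ++ [] :: G').zip (L ++ y :: M') =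
        (G.zip L).map (fun e => (p :: e.1, e.2)) ++ ([], y) :: G'.zip M' := by
    rw [List.zip_append (by rw [List.length_map]; omega), List.zip_map_left, List.zip_cons_cons]
    rfl
  have hle (L : List α) (hL : L.length + 1 = c.numLeaves) :
      (∀ e ∈ G.zip L, e.2 ≤ x) ↔ ∀ y ∈ L, y ≤ x := by
    rw [← List.forall_mem_map (f := Prod.snd) (P := (· ≤ x)), List.map_snd_zip (by omega)]
  have hiff (L M' : List α) :=
    ancestorMonotone_append_root (p := p) (x := x) (E := G.zip L) (E' := G'.zip M')
      fun q u y h => hG' q u (List.of_mem_zip h).1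
  constructor
  · rintro ⟨hx, L, M', rfl, hL, hLx, hM'⟩
    obtain ⟨hlen, hL⟩ := (hc L).1 hL
    obtain ⟨hlen', hM'⟩ := (hcs M').1 ⟨hx, hM'⟩
    refine ⟨by simp [← hlen', ← hlen]; omega, ?_⟩
    rw [hsplit L M' x hlen]
    exact ((hiff L M').2 ⟨hL, (hle L hlen).2 hLx, hM'⟩).subset (by simp)
  · rintro ⟨hlen, h⟩
    obtain ⟨L, y, M', rfl, hL⟩ : ∃ L y M', M = L ++ y :: M' ∧ L.length + 1 = c.numLeaves := by
      rw [List.map_cons, List.sum_cons, ← hG] at hlen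
      exact ⟨M.take G.length, M[G.length], M.drop (G.length + 1), by simp, by simp; omega⟩
    rw [hsplit L M' y hL] at h
    obtain rfl : x = y := le_antisymm (h.2 ([], x) (by simp) ([], y) (by simp) (by simp))
      (h.2 ([], y) (by simp) ([], x) (by simp) (by simp))
    obtain ⟨h₁, h₂, h₃⟩ := (hiff L M').1 (h.subset (by simp))
    obtain ⟨hx, hM'⟩ := (hcs M').2 ⟨by simp [← hL] at hlen; omega, h₃⟩
    exact ⟨hx, L, M', rfl, (hc L).2 ⟨hL, h₁⟩, (hle L hL).1 h₂, hM'⟩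

mutual
theorem monotoneGaps_le_iff : ∀ {T : PlaneTree} {L : List α}, T.StrictlyBranching →
    (MonotoneGaps (· ≤ ·) T L ↔ L.length + 1 = T.numLeaves ∧
      AncestorMonotone ((neighbourAncestors T.leafPaths).zip L))
  | node [], L, _ => by
    simp [MonotoneGaps, numLeaves, leafPaths, neighbourAncestors, AncestorMonotone]
  | node (c :: cs), L, hT => by
    set G := neighbourAncestors (forestLeafPaths 0 (c :: cs)) with hG
    have hlen : G.length + 1 = (node (c :: cs)).numLeaves := by
      rw [← length_neighbourAncestors_leafPaths, leafPaths]
    have hroot (x : α) : 0 ≤ x ∧ ForestMonotoneGaps (· ≤ ·) x (c :: cs) (L ++ [x]) ↔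
        L.length + 1 = (node (c :: cs)).numLeaves ∧
          AncestorMonotone (([], x) :: (G ++ [[]]).zip (L ++ [x])) := by
      rw [forestMonotoneGaps_le_iff (p := 0) fun c hc => hT.of_mem hc,
        neighbourAncestors_append_nil (by simp [forestLeafPaths, c.leafPaths_ne_nil]),
        numLeaves_node (List.cons_ne_nil c cs), List.length_append, List.length_singleton]
    simp only [monotoneGaps_node (List.cons_ne_nil c cs), hroot, leafPaths, ← hG]
    rw [exists_and_left]
    refine and_congr_right fun hL => ?_
    simp only [List.zip_append (show G.length = L.length by omega)]
    refine ⟨fun ⟨x, h⟩ => h.subset (by simp), fun h => ?_⟩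
    obtain ⟨x, hx⟩ : ∃ x, ([], x) ∈ G.zip L := by
      have hnil := nil_mem_neighbourAncestors (hT.two_le_length (by simp)) 0
      rw [← hG, ← List.map_fst_zip (l₁ := G) (l₂ := L) (by omega)] at hnil
      simpa using hnil
    exact ⟨x, h.subset (by simp [hx])⟩
theorem forestMonotoneGaps_le_iff : ∀ {p : ℕ} {cs : List PlaneTree} {x : α} {M : List α},
    (∀ c ∈ cs, c.StrictlyBranching) →
    (0 ≤ x ∧ ForestMonotoneGaps (· ≤ ·) x cs M ↔
      M.length = (cs.map numLeaves).sum ∧ AncestorMonotone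
        (([], x) :: (neighbourAncestors (forestLeafPaths p cs ++ [[]])).zip M))
  | p, [], x, M, _ => by
    simp [ForestMonotoneGaps, forestLeafPaths, neighbourAncestors, AncestorMonotone, and_comm]
  | p, c :: cs, x, M, hcs =>
    forestMonotoneGaps_le_cons_iff (fun L => monotoneGaps_le_iff (hcs c (by simp)))
      (fun M => forestMonotoneGaps_le_iff fun c hc => hcs c (by simp [hc]))
end

theorem monotoneGaps_le_iff_labeledVertex {T : PlaneTree} (hT : T.StrictlyBranching) {L : List α} :
    MonotoneGaps (· ≤ ·) T L ↔ L.length + 1 = T.numLeaves ∧ (∀ y ∈ L, 0 ≤ y) ∧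
      ∀ (i j : ℕ) (hi : i < L.length) (hj : j < L.length),
        T.labeledVertex (j + 1) <+: T.labeledVertex (i + 1) → L[i] ≤ L[j] := by
  rw [monotoneGaps_le_iff hT]
  refine and_congr_right fun hL => ?_
  have hlen : L.length = (neighbourAncestors T.leafPaths).length := by
    have := length_neighbourAncestors_leafPaths T
    omega
  refine and_congr ?_ ?_
  · rw [← List.forall_mem_map (f := Prod.snd) (P := (0 ≤ ·)), List.map_snd_zip hlen.le]
  · constructor
    · intro h i j hi hj hij
      rw [T.labeledVertex_add_one (hlen ▸ hj), T.labeledVertex_add_one (hlen ▸ hi)] at hij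
      have hmem (k : ℕ) (hk : k < L.length) :
          ((neighbourAncestors T.leafPaths)[k], L[k]) ∈ (neighbourAncestors T.leafPaths).zip L :=
        List.mem_iff_getElem.2 ⟨k, by simp; omega, List.getElem_zip⟩
      exact h _ (hmem i hi) _ (hmem j hj) hij
    · intro h e he e' he' hee'
      obtain ⟨i, hi, rfl⟩ := List.getElem_of_mem he
      obtain ⟨j, hj, rfl⟩ := List.getElem_of_mem he'
      simp only [List.length_zip, lt_inf_iff] at hi hj
      simp only [List.getElem_zip] at hee' ⊢
      refine h i j hi.2 hj.2 ?_
      rwa [T.labeledVertex_add_one hj.1, T.labeledVertex_add_one hi.1]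

end LabeledVertex

end PlaneTree

/-! ### Blocks of ordered partitions -/

namespace OrderedPartition

variable {n : ℕ} {S S' : OrderedPartition n}

/-- The position of the block of `S` that contains `x`, counted from `0`. -/
def index (S : OrderedPartition n) (x : Fin n) : ℕ := S.blocks.findIdx (x ∈ ·)

theorem index_lt (S : OrderedPartition n) (x : Fin n) : S.index x < S.blocks.length :=
  List.findIdx_lt_length.2 (by simpa using S.cover x)

theorem mem_getElem_iff {x : Fin n} {a : ℕ} (ha : a < S.blocks.length) :
    x ∈ S.blocks[a] ↔ S.index x = a := by
  have hx : x ∈ S.blocks[S.index x]'(S.index_lt x) :=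
    decide_eq_true_iff.1 (List.findIdx_getElem (w := S.index_lt x))
  refine ⟨fun hxa => ?_, fun h => by simpa only [h] using hx⟩
  simpa using (S.existsUnique_index x).unique (y₁ := ⟨_, S.index_lt x⟩) (y₂ := ⟨a, ha⟩) hx hxa

theorem exists_index_eq {a : ℕ} (ha : a < S.blocks.length) : ∃ x, S.index x = a := by
  obtain ⟨x, hx⟩ := S.nonempty _ (List.getElem_mem ha)
  exact ⟨x, (mem_getElem_iff ha).1 hx⟩

theorem le_iff_index_le {x y : Fin n} : S.Le x y ↔ S.index x ≤ S.index y := by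
  constructor
  · rintro ⟨a, b, hab, hx, hy⟩
    rw [List.get_eq_getElem, mem_getElem_iff] at hx hy
    rwa [hx, hy]
  · intro h
    exact ⟨⟨_, S.index_lt x⟩, ⟨_, S.index_lt y⟩, h, (mem_getElem_iff _).2 rfl,
      (mem_getElem_iff _).2 rfl⟩

theorem equiv_iff_index_eq {x y : Fin n} : S.Equiv x y ↔ S.index x = S.index y := by
  rw [Equiv, le_iff_index_le, le_iff_index_le, ← le_antisymm_iff]

theorem index_le_of_forall_lt (h : ∀ x y, S.index x < S.index y → S'.index x < S'.index y)
    (x : Fin n) : S.index x ≤ S'.index x := by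
  induction hx : S.index x generalizing x with
  | zero => exact Nat.zero_le _
  | succ a ih =>
    obtain ⟨y, hy⟩ := exists_index_eq (S := S) (a := a) (by have := S.index_lt x; omega)
    have := ih y hy
    have := h y x (by omega)
    omega

theorem length_le_of_index_le (h : ∀ x, S.index x ≤ S'.index x) :
    S.blocks.length ≤ S'.blocks.length := by
  by_contra! hlt
  obtain ⟨x, hx⟩ := exists_index_eq hlt
  have := h x
  have := S'.index_lt x
  omega

theorem eq_of_le_iff_le (h : ∀ x y, S.Le x y ↔ S'.Le x y) : S = S' := by
  simp only [le_iff_index_le] at h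
  have hlt (x y : Fin n) : S.index x < S.index y ↔ S'.index x < S'.index y := by
    simpa only [not_le] using not_congr (h y x)
  have hindex (x : Fin n) : S.index x = S'.index x :=
    (index_le_of_forall_lt (fun x y => (hlt x y).1) x).antisymm
      (index_le_of_forall_lt (fun x y => (hlt x y).2) x)
  have hblocks : S.blocks = S'.blocks := by
    refine List.ext_getElem ((length_le_of_index_le fun x => (hindex x).le).antisymm
      (length_le_of_index_le fun x => (hindex x).ge)) fun a ha ha' => ?_
    ext x
    rw [mem_getElem_iff, mem_getElem_iff, hindex]
  cases S
  cases S'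
  congr

theorem card_filter_index_lt {b : ℕ} (hb : b ≤ S.blocks.length) :
    (Finset.univ.filter (S.index · < b)).card = S.typeAt b := by
  induction b with
  | zero => simp [typeAt]
  | succ b ih =>
    have hblock : S.blocks[b] = Finset.univ.filter (S.index · = b) := by
      ext x
      simp [mem_getElem_iff]
    have hdisj : Disjoint (Finset.univ.filter (S.index · < b))
        (Finset.univ.filter (S.index · = b)) :=
      Finset.disjoint_filter.2 fun x _ h h' => h.ne h'
    simp only [Nat.lt_succ_iff_lt_or_eq, Finset.filter_or]
    rw [Finset.card_union_of_disjoint hdisj, ih (Nat.le_of_succ_le hb), ← hblock, typeAt, typeAt,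
      ← List.take_append_getElem hb, List.map_append, List.sum_append]
    simp

theorem typeAt_length (S : OrderedPartition n) : S.typeAt S.blocks.length = n := by
  simp [← card_filter_index_lt le_rfl, index_lt]

theorem typeAt_lt_typeAt {a b : ℕ} (hab : a < b) (hb : b ≤ S.blocks.length) :
    S.typeAt a < S.typeAt b := by
  rw [← card_filter_index_lt hb, ← card_filter_index_lt (hab.le.trans hb)]
  obtain ⟨x, hx⟩ := exists_index_eq (hab.trans_le hb)
  refine Finset.card_lt_card (Finset.ssubset_iff_of_subset ?_ |>.2 ⟨x, by simpa [hx], by simp [hx]⟩)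
  exact Finset.monotone_filter_right _ fun y _ hy => hy.trans hab

theorem typeAt_injOn : Set.InjOn S.typeAt {a | a ≤ S.blocks.length} :=
  StrictMonoOn.injOn fun _ _ _ hb hab => typeAt_lt_typeAt hab hb

theorem monotone_index_of_refines {π : Equiv.Perm (Fin n)} (h : (ofPerm π).Refines S) :
    Monotone (S.index ∘ π.symm) := by
  have hmono := (S.refines_ofPerm_iff (f := fun x => ⟨S.index x, S.index_lt x⟩)
    (fun x a => by rw [List.get_eq_getElem, mem_getElem_iff, Fin.ext_iff]) π).1 h
  exact fun a b hab => hmono hab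

theorem index_symm_lt_iff {π : Equiv.Perm (Fin n)} (h : (ofPerm π).Refines S) {b : ℕ}
    (hb : b ≤ S.blocks.length) (a : Fin n) : S.index (π.symm a) < b ↔ a < S.typeAt b := by
  have hmono := monotone_index_of_refines h
  have hcard : (Finset.univ.filter fun c => S.index (π.symm c) < b).card = S.typeAt b := by
    rw [← card_filter_index_lt hb]
    exact Finset.card_equiv π.symm (by simp)
  rw [← hcard]
  refine ⟨fun ha => ?_, fun ha => ?_⟩
  · have hsub : Finset.Iic a ⊆ Finset.univ.filter fun c => S.index (π.symm c) < b := fun c hc =>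
      Finset.mem_filter.2 ⟨Finset.mem_univ c, (hmono (Finset.mem_Iic.1 hc)).trans_lt ha⟩
    simpa using Finset.card_le_card hsub
  · by_contra! hb'
    have hsub : (Finset.univ.filter fun c => S.index (π.symm c) < b) ⊆ Finset.Iio a := by
      intro c hc
      rw [Finset.mem_Iio]
      by_contra! hac
      exact ((Finset.mem_filter.1 hc).2.trans_le hb').not_ge (hmono hac)
    simpa using ha.trans_le (Finset.card_le_card hsub)

theorem mem_foldr_union {α : Type*} [DecidableEq α] {M : List (Finset α)} {x : α} :
    x ∈ M.foldr (· ∪ ·) ∅ ↔ ∃ B ∈ M, x ∈ B := by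
  induction M with
  | nil => simp
  | cons B M ih => simp [ih]

theorem exists_merge {A M C : List (Finset (Fin n))} (h : S.blocks = A ++ (M ++ C))
    (hM : M ≠ []) :
    ∃ S' : OrderedPartition n, S'.blocks = A ++ M.foldr (· ∪ ·) ∅ :: C := by
  have hne := S.nonempty
  have hdisj := S.disjoint
  have hcover := S.cover
  rw [h] at hne hdisj hcover
  simp only [List.forall_mem_append] at hne
  refine ⟨⟨_, ?_, ?_, fun x => ?_⟩, rfl⟩
  · obtain ⟨B, hB⟩ := List.exists_mem_of_ne_nil M hM
    obtain ⟨x, hx⟩ := hne.2.1 B hB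
    simp only [List.forall_mem_append, List.forall_mem_cons]
    exact ⟨hne.1, ⟨x, mem_foldr_union.2 ⟨B, hB, hx⟩⟩, hne.2.2⟩
  · simp only [List.pairwise_append, List.pairwise_cons, List.mem_append, List.mem_cons,
      or_imp, forall_and, forall_eq, Finset.disjoint_left, mem_foldr_union] at hdisj ⊢
    grind
  · simp only [List.mem_append, List.mem_cons, or_and_right, exists_or, exists_eq_left,
      mem_foldr_union] at hcover ⊢
    exact hcover x

theorem index_merge {A M C : List (Finset (Fin n))} (h : S.blocks = A ++ (M ++ C))
    (h' : S'.blocks = A ++ M.foldr (· ∪ ·) ∅ :: C) (x : Fin n) :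
    S'.index x = if S.index x < A.length then S.index x
      else if S.index x < A.length + M.length then A.length else S.index x + 1 - M.length := by
  have hunion : x ∈ M.foldr (· ∪ ·) ∅ ↔ M.findIdx (x ∈ ·) < M.length := by
    simp [mem_foldr_union, List.findIdx_lt_length]
  simp only [index, h, h', List.findIdx_append, List.findIdx_cons, hunion]
  grind

end OrderedPartition

/-! ### Coordinates on `W_S` -/

section HasGaps

variable {d : ℕ} {S S' : OrderedPartition (d + 1)} {w : W d} {L : List ℝ}

theorem coordDiff_mk (x y : Fin (d + 1)) (v : Fin (d + 1) → ℝ) :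
    coordDiff x y (Submodule.Quotient.mk v : W d) = v x - v y := by
  simp [coordDiff]

theorem coordDiff_self (x : Fin (d + 1)) : coordDiff x x w = 0 := by
  induction w using Submodule.Quotient.induction_on with
  | H v => rw [coordDiff_mk, sub_self]

theorem coordDiff_add (x y z : Fin (d + 1)) :
    coordDiff x y w + coordDiff y z w = coordDiff x z w := by
  induction w using Submodule.Quotient.induction_on with
  | H v => simp only [coordDiff_mk, sub_add_sub_cancel]

/-- The point `w` lies in `W_S`, and `L = (c_2 - c_1, …, c_k - c_{k-1})` is the list of the gaps
between the values `c_a` of `w` on the blocks `S_1, …, S_k`. -/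
def HasGaps (S : OrderedPartition (d + 1)) (w : W d) (L : List ℝ) : Prop :=
  L.length + 1 = S.blocks.length ∧
    ∀ x y, coordDiff y x w = (L.take (S.index y)).sum - (L.take (S.index x)).sum

theorem exists_hasGaps (hL : L.length + 1 = S.blocks.length) : ∃ w, HasGaps S w L :=
  ⟨Submodule.Quotient.mk fun x => (L.take (S.index x)).sum, hL, fun _ _ => coordDiff_mk _ _ _⟩

theorem HasGaps.mem_WS (h : HasGaps S w L) : w ∈ WS S := fun x y hxy => by
  rw [h.2, OrderedPartition.equiv_iff_index_eq.1 hxy, sub_self]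

theorem exists_representatives (S : OrderedPartition (d + 1)) :
    ∃ x : ℕ → Fin (d + 1), ∀ a < S.blocks.length, S.index (x a) = a := by
  choose! x hx using fun a (ha : a < S.blocks.length) => S.exists_index_eq ha
  exact ⟨x, hx⟩

theorem exists_hasGaps_of_mem_WS (hw : w ∈ WS S) : ∃ L, HasGaps S w L := by
  obtain ⟨x, hx⟩ := exists_representatives S
  have hlen : 0 < S.blocks.length := (Nat.zero_le _).trans_lt (S.index_lt 0)
  set L := (List.range (S.blocks.length - 1)).map fun a => coordDiff (x (a + 1)) (x a) w with hL
  have hsum (a : ℕ) (ha : a < S.blocks.length) : (L.take a).sum = coordDiff (x a) (x 0) w := by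
    induction a with
    | zero => simp [coordDiff_self]
    | succ a ih =>
      rw [List.sum_take_succ _ _ (by simp [hL]; omega), ih (by omega), add_comm]
      simp [hL, coordDiff_add]
  have hrep (y : Fin (d + 1)) : coordDiff y (x (S.index y)) w = 0 :=
    hw _ _ (OrderedPartition.equiv_iff_index_eq.2 (hx _ (S.index_lt y)).symm)
  refine ⟨L, by simp [hL]; omega, fun y z => ?_⟩
  rw [hsum _ (S.index_lt y), hsum _ (S.index_lt z)]
  linear_combination hrep z - hrep y + coordDiff_add (w := w) z y (x 0) -
    coordDiff_add (w := w) z (x (S.index z)) (x 0) + coordDiff_add (w := w) y (x (S.index y)) (x 0)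

theorem HasGaps.coordDiff_eq (h : HasGaps S w L) {i : ℕ} (hi : i < L.length) {x y : Fin (d + 1)}
    (hx : S.index x = i) (hy : S.index y = i + 1) : coordDiff y x w = L[i] := by
  rw [h.2, hx, hy, List.sum_take_succ _ _ hi, add_sub_cancel_left]

theorem exists_linearMap_eq_getD (S : OrderedPartition (d + 1)) (i : ℕ) :
    ∃ φ : W d →ₗ[ℝ] ℝ, ∀ w L, HasGaps S w L → φ w = L.getD i 0 := by
  obtain ⟨x, hx⟩ := exists_representatives S
  by_cases hi : i + 1 < S.blocks.length
  · refine ⟨coordDiff (x (i + 1)) (x i), fun w L h => ?_⟩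
    have hiL : i < L.length := by have := h.1; omega
    rw [h.coordDiff_eq hiL (hx i (by omega)) (hx (i + 1) hi), List.getD_eq_getElem _ _ hiL]
  · refine ⟨0, fun w L h => ?_⟩
    rw [List.getD_eq_default _ _ (by have := h.1; omega), LinearMap.zero_apply]

theorem HasGaps.unique {L' : List ℝ} (h : HasGaps S w L) (h' : HasGaps S w L') : L = L' := by
  refine List.ext_getElem (by have := h.1; have := h'.1; omega) fun i hi hi' => ?_
  obtain ⟨φ, hφ⟩ := exists_linearMap_eq_getD S i
  rw [← List.getD_eq_getElem _ 0 hi, ← List.getD_eq_getElem _ 0 hi', ← hφ w L h, ← hφ w L' h']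

theorem strictMonoOn_sum_take (hL : ∀ y ∈ L, 0 < y) :
    StrictMonoOn (fun a => (L.take a).sum) {a | a ≤ L.length} := by
  intro a _ b hb hab
  obtain ⟨k, rfl⟩ := Nat.exists_eq_add_of_lt hab
  rw [Set.mem_ofPred_eq] at hb
  simp only [add_assoc a k 1, List.take_add (i := a), List.sum_append]
  have hsub : ∀ y ∈ (L.drop a).take (k + 1), 0 < y := fun y hy =>
    hL y (List.mem_of_mem_drop (List.mem_of_mem_take hy))
  exact lt_add_of_pos_right _ (List.sum_pos _ hsub (by simp; omega))

theorem HasGaps.le_iff_coordDiff_nonpos (h : HasGaps S w L) (hL : ∀ y ∈ L, 0 < y)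
    {x y : Fin (d + 1)} : S.Le x y ↔ coordDiff x y w ≤ 0 := by
  have hle (z : Fin (d + 1)) : S.index z ≤ L.length := by
    have := h.1
    have := S.index_lt z
    omega
  rw [OrderedPartition.le_iff_index_le, h.2, sub_nonpos]
  exact ((strictMonoOn_sum_take hL).le_iff_le (hle x) (hle y)).symm

theorem sum_take_merge (U V : List ℝ) {m : ℕ} (hm : m ≠ 0) (i : ℕ) :
    ((U ++ (List.replicate (m - 1) 0 ++ V)).take i).sum = ((U ++ V).take (if i < U.length then i
      else if i < U.length + m then U.length else i + 1 - m)).sum := by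
  simp only [List.take_append, List.sum_append, List.take_replicate, List.sum_replicate, smul_zero,
    List.length_replicate, zero_add]
  split_ifs with hU hm'
  · simp [Nat.sub_eq_zero_of_le hU.le]
  · rw [List.take_of_length_le (not_lt.1 hU), List.take_length, Nat.sub_self,
      show i - U.length - (m - 1) = 0 by omega]
  · rw [List.take_of_length_le (not_lt.1 hU),
      List.take_of_length_le (show U.length ≤ i + 1 - m by omega),
      show i - U.length - (m - 1) = i + 1 - m - U.length by omega]

theorem hasGaps_merge_iff {A M C : List (Finset (Fin (d + 1)))} {U V : List ℝ}
    (h : S.blocks = A ++ (M ++ C)) (hM : M ≠ [])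
    (h' : S'.blocks = A ++ M.foldr (· ∪ ·) ∅ :: C) (hU : U.length = A.length) :
    HasGaps S' w (U ++ V) ↔ HasGaps S w (U ++ (List.replicate (M.length - 1) 0 ++ V)) := by
  have hpos := List.length_pos_iff.2 hM
  simp only [HasGaps, sum_take_merge U V hpos.ne', OrderedPartition.index_merge h h', ← hU]
  simp only [h, h', List.length_append, List.length_cons, List.length_replicate]
  refine and_congr_left fun _ => ?_
  omega

theorem HasGaps.D_eq {π : Equiv.Perm (Fin (d + 1))} (h : HasGaps S w L)
    (hπ : (OrderedPartition.ofPerm π).Refines S) {i : ℕ} (hi : i < L.length) {l : Fin d}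
    (hl : l + 1 = S.typeAt (i + 1)) : D π l w = L[i] := by
  have hlt := h.1
  have hlast := S.index_symm_lt_iff hπ (b := i + 1) (by omega)
  have hcast := (hlast l.castSucc).2 (by simp; omega)
  have hsucc := (hlast l.succ).not.2 (by simp; omega)
  have hcast' := (S.index_symm_lt_iff hπ (b := i) (by omega) l.castSucc).not.2 (by
    have := S.typeAt_lt_typeAt (a := i) (b := i + 1) (by omega) (by omega)
    simp; omega)
  have hsucc' := (S.index_symm_lt_iff hπ (b := i + 2) (by omega) l.succ).2 (by
    have := S.typeAt_lt_typeAt (a := i + 1) (b := i + 2) (by omega) (by omega)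
    simp; omega)
  exact h.coordDiff_eq hi (by omega) (by omega)

end HasGaps

/-! ### Faces of polyhedra -/

section Polyhedron

variable {V ι : Type*} [AddCommGroup V] [Module ℝ V]

theorem isExtreme_sep_eq_zero {C : Set V} {φ : V →ₗ[ℝ] ℝ} (hφ : ∀ x ∈ C, 0 ≤ φ x) :
    IsExtreme ℝ C {x ∈ C | φ x = 0} where
  subset := Set.sep_subset _ _
  left_mem_of_mem_openSegment := by
    rintro x hx y hy _ ⟨-, hz⟩ ⟨s, t, hs, ht, -, rfl⟩
    refine ⟨hx, ?_⟩
    simp only [map_add, map_smul, smul_eq_mul] at hz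
    have hsx := mul_nonneg hs.le (hφ x hx)
    have hty := mul_nonneg ht.le (hφ y hy)
    exact (mul_eq_zero.1 (by linarith : s * φ x = 0)).resolve_left hs.ne'

/-- The polyhedron `{x | a i x ≥ b i for all i}`. -/
def polyhedron (a : ι → V →ₗ[ℝ] ℝ) (b : ι → ℝ) : Set V := {x | ∀ i, b i ≤ a i x}

variable {a : ι → V →ₗ[ℝ] ℝ} {b : ι → ℝ} {F : Set V}

theorem convex_polyhedron : Convex ℝ (polyhedron a b) := by
  simp only [polyhedron, Set.ofPred_forall]
  exact convex_iInter fun i => convex_halfSpace_ge (a i).isLinear (b i)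

theorem exists_forall_tight [Finite ι] (hconv : Convex ℝ F) (hF : F ⊆ polyhedron a b)
    (hne : F.Nonempty) : ∃ w ∈ F, ∀ x ∈ F, ∀ i, a i w = b i → a i x = b i := by
  obtain ⟨w, hw, hmin⟩ := exists_minimalFor_of_wellFoundedLT (· ∈ F)
    (fun w => {i | a i w = b i}) hne
  refine ⟨w, hw, fun x hx i hi => ?_⟩
  have hmid : ∀ j, a j (midpoint ℝ w x) = b j → a j w = b j ∧ a j x = b j := by
    intro j hj
    have hwj := hF hw j
    have hxj := hF hx j
    rw [midpoint_eq_smul_add, map_smul, map_add, smul_eq_mul, invOf_eq_inv] at hj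
    constructor <;> linarith
  exact (hmid i (hmin (hconv.midpoint_mem hw hx) (fun j hj => (hmid j hj).1) hi)).2

open scoped Topology in
theorem eventually_add_smul_sub_mem_polyhedron [Finite ι] {w x : V} (hw : w ∈ polyhedron a b)
    (hx : ∀ i, a i w = b i → a i x = b i) :
    ∀ᶠ ε in 𝓝[>] (0 : ℝ), w + ε • (w - x) ∈ polyhedron a b := by
  refine Filter.eventually_all.2 fun i => ?_
  simp only [map_add, map_smul, map_sub, smul_eq_mul]
  rcases (hw i).eq_or_lt with hi | hi
  · simp [hx i hi.symm, hi]
  · have hcont : Continuous fun ε : ℝ => a i w + ε * (a i w - a i x) := by fun_prop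
    refine nhdsWithin_le_nhds ((hcont.continuousAt.eventually_const_lt ?_).mono fun _ => le_of_lt)
    simpa using hi

theorem mem_of_isExtreme_of_tight [Finite ι] (hext : IsExtreme ℝ (polyhedron a b) F) {w x : V}
    (hw : w ∈ F) (hx : x ∈ polyhedron a b) (h : ∀ i, a i w = b i → a i x = b i) : x ∈ F := by
  obtain ⟨ε, hmem, hε⟩ := ((eventually_add_smul_sub_mem_polyhedron (hext.subset hw) h).and
    self_mem_nhdsWithin).exists
  refine hext.left_mem_of_mem_openSegment hx hmem hw
    ⟨ε / (1 + ε), 1 / (1 + ε), by positivity, by positivity, by field_simp; ring, ?_⟩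
  match_scalars
  · field_simp
    ring
  · field_simp

theorem exists_eq_maximizers_of_isExtreme [Finite ι] (hext : IsExtreme ℝ (polyhedron a b) F)
    (hconv : Convex ℝ F) (hne : F.Nonempty) :
    ∃ l : V →ₗ[ℝ] ℝ, F = {x | x ∈ polyhedron a b ∧ ∀ y ∈ polyhedron a b, l y ≤ l x} := by
  classical
  have := Fintype.ofFinite ι
  obtain ⟨w, hw, htight⟩ := exists_forall_tight hconv hext.subset hne
  set I : Finset ι := {i | a i w = b i} with hI
  have hsum (x : V) : (-∑ i ∈ I, a i) x = -∑ i ∈ I, a i x := by simp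
  have hle (y : V) (hy : y ∈ polyhedron a b) : ∑ i ∈ I, b i ≤ ∑ i ∈ I, a i y :=
    Finset.sum_le_sum fun i _ => hy i
  have hF (x : V) (hx : x ∈ F) : ∑ i ∈ I, a i x = ∑ i ∈ I, b i :=
    Finset.sum_congr rfl fun i hi => htight x hx i (by simpa [hI] using hi)
  refine ⟨-∑ i ∈ I, a i, Set.ext fun x => ⟨fun hx => ⟨hext.subset hx, fun y hy => ?_⟩, ?_⟩⟩
  · rw [hsum, hsum, hF x hx]
    exact neg_le_neg (hle y hy)
  · rintro ⟨hx, hmax⟩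
    have hxw := hmax w (hext.subset hw)
    rw [hsum, hsum, hF w hw, neg_le_neg_iff] at hxw
    have heq := (Finset.sum_eq_sum_iff_of_le fun i _ => hx i).1 ((hle x hx).antisymm hxw)
    exact mem_of_isExtreme_of_tight hext hw hx fun i hi => (heq i (by simpa [hI] using hi)).symm

end Polyhedron

/-! ### The cones -/

namespace PartitionLabeledTree

variable {d : ℕ} {P Q : PartitionLabeledTree d} {w : W d}

theorem typeAt_inj (P : PartitionLabeledTree d) {i j : ℕ} (hi : i < P.tree.numLeaves)
    (hj : j < P.tree.numLeaves) (h : P.part.typeAt i = P.part.typeAt j) : i = j :=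
  P.part.typeAt_injOn (P.length_eq ▸ hi.le) (P.length_eq ▸ hj.le) h

theorem exists_add_one_eq_typeAt (P : PartitionLabeledTree d) {i : ℕ}
    (hi : i + 1 < P.tree.numLeaves) : ∃ l : Fin d, l + 1 = P.part.typeAt (i + 1) := by
  rw [← P.length_eq] at hi
  have hpos : P.part.typeAt 0 < P.part.typeAt (i + 1) := P.part.typeAt_lt_typeAt (by omega) hi.le
  have hlt := P.part.typeAt_lt_typeAt hi le_rfl
  rw [P.part.typeAt_length] at hlt
  exact ⟨⟨P.part.typeAt (i + 1) - 1, by omega⟩, Nat.sub_add_cancel (by omega)⟩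

theorem prec_typeAt_iff (P : PartitionLabeledTree d) {i j : ℕ} (hi : i + 1 < P.tree.numLeaves)
    (hj : j + 1 < P.tree.numLeaves) :
    P.Prec (P.part.typeAt (i + 1)) (P.part.typeAt (j + 1)) ↔
      P.tree.labeledVertex (j + 1) <+: P.tree.labeledVertex (i + 1) := by
  constructor
  · rintro ⟨a, b, ⟨-, ha⟩, ⟨-, hb⟩, hia, hjb, h⟩
    rwa [P.typeAt_inj hi ha hia, P.typeAt_inj hj hb hjb]
  · exact fun h => ⟨_, _, ⟨i.succ_pos, hi⟩, ⟨j.succ_pos, hj⟩, rfl, rfl, h⟩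

theorem exists_isMinimalLabel (P : PartitionLabeledTree d) {i : ℕ}
    (hi : i + 1 < P.tree.numLeaves) : ∃ j, j + 1 < P.tree.numLeaves ∧
      P.tree.labeledVertex (i + 1) <+: P.tree.labeledVertex (j + 1) ∧
      P.IsMinimalLabel (P.part.typeAt (j + 1)) := by
  obtain ⟨j, hj, hmax⟩ := Finset.exists_max_image
    ((Finset.range (P.tree.numLeaves - 1)).filter fun j =>
      P.tree.labeledVertex (i + 1) <+: P.tree.labeledVertex (j + 1))
    (fun j => (P.tree.labeledVertex (j + 1)).length) ⟨i, by simp; omega⟩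
  simp only [Finset.mem_filter, Finset.mem_range] at hj hmax
  have hj' : j + 1 < P.tree.numLeaves := by omega
  refine ⟨j, hj', hj.2, ⟨j + 1, j.succ_pos, hj', rfl⟩, fun m hm => ?_⟩
  obtain ⟨a, -, ⟨ha, ha'⟩, -, rfl, -, -⟩ := id hm
  obtain ⟨a, rfl⟩ := Nat.exists_eq_add_of_le' ha
  rw [P.prec_typeAt_iff ha' hj'] at hm
  rw [P.prec_typeAt_iff hj' ha', hm.eq_of_length_le (hmax a ⟨by omega, hj.2.trans hm⟩)]

/-- The points of `W_S` whose list of gaps is monotone for `r` on the tree `T`. For `r = (≤)` this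
is the cone `σ(S, T)`, for `r = (<)` the relative interior of that cone. -/
def gapCone (r : ℝ → ℝ → Prop) (P : PartitionLabeledTree d) : Set (W d) :=
  {w | ∃ L, HasGaps P.part w L ∧ P.tree.MonotoneGaps r L}

theorem mem_coneWith_iff {π : Equiv.Perm (Fin (d + 1))} {L : List ℝ}
    (hπ : (OrderedPartition.ofPerm π).Refines P.part) (hL : HasGaps P.part w L) :
    w ∈ P.coneWith π ↔ P.tree.MonotoneGaps (· ≤ ·) L := by
  have hlen : L.length + 1 = P.tree.numLeaves := hL.1.trans P.length_eq
  rw [PlaneTree.monotoneGaps_le_iff_labeledVertex P.branching]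
  constructor
  · rintro ⟨-, hprec, hmin⟩
    have hle (i j : ℕ) (hi : i < L.length) (hj : j < L.length)
        (hij : P.tree.labeledVertex (j + 1) <+: P.tree.labeledVertex (i + 1)) : L[i] ≤ L[j] := by
      obtain ⟨k, hk⟩ := P.exists_add_one_eq_typeAt (i := i) (by omega)
      obtain ⟨l, hl⟩ := P.exists_add_one_eq_typeAt (i := j) (by omega)
      rw [← hL.D_eq hπ hi hk, ← hL.D_eq hπ hj hl]
      exact hprec k l (by rwa [hk, hl, P.prec_typeAt_iff (by omega) (by omega)])
    refine ⟨hlen, List.forall_mem_iff_getElem.2 fun i hi => ?_, hle⟩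
    obtain ⟨j, hj, hij, hjmin⟩ := P.exists_isMinimalLabel (i := i) (by omega)
    obtain ⟨l, hl⟩ := P.exists_add_one_eq_typeAt hj
    refine le_trans ?_ (hle j i (by omega) hi hij)
    rw [← hL.D_eq hπ _ hl]
    exact hmin l (hl ▸ hjmin)
  · rintro ⟨-, hpos, hle⟩
    refine ⟨hL.mem_WS, fun k l hkl => ?_, ?_⟩
    · obtain ⟨i, j, ⟨hi, hi'⟩, ⟨hj, hj'⟩, hk, hl, hij⟩ := hkl
      obtain ⟨i, rfl⟩ := Nat.exists_eq_add_of_le' hi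
      obtain ⟨j, rfl⟩ := Nat.exists_eq_add_of_le' hj
      rw [hL.D_eq hπ (by omega) hk, hL.D_eq hπ (by omega) hl]
      exact hle i j _ _ hij
    · rintro l ⟨⟨i, hi, hi', hl⟩, -⟩
      obtain ⟨i, rfl⟩ := Nat.exists_eq_add_of_le' hi
      rw [hL.D_eq hπ (by omega) hl]
      exact hpos _ (List.getElem_mem _)

theorem cone_eq_gapCone (P : PartitionLabeledTree d) : P.cone = P.gapCone (· ≤ ·) := by
  obtain ⟨π, hπ⟩ := P.part.exists_refines
  rw [P.cone_eq hπ]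
  ext w
  constructor
  · intro hw
    obtain ⟨L, hL⟩ := exists_hasGaps_of_mem_WS hw.1
    exact ⟨L, hL, (mem_coneWith_iff hπ hL).1 hw⟩
  · rintro ⟨L, hL, hT⟩
    exact (mem_coneWith_iff hπ hL).2 hT

theorem gapCone_lt_subset_cone (P : PartitionLabeledTree d) : P.gapCone (· < ·) ⊆ P.cone := by
  rw [P.cone_eq_gapCone]
  exact fun w ⟨L, hL, hT⟩ => ⟨L, hL, hT.imp fun _ _ => le_of_lt⟩

theorem gapCone_lt_nonempty (P : PartitionLabeledTree d) : (P.gapCone (· < ·)).Nonempty := by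
  obtain ⟨L, hT⟩ := PlaneTree.exists_monotoneGaps_lt (α := ℝ) P.tree
  obtain ⟨w, hL⟩ := exists_hasGaps (hT.length_add_one.trans P.length_eq.symm)
  exact ⟨w, L, hL, hT⟩

theorem eq_of_mem_gapCone_lt (hP : w ∈ P.gapCone (· < ·)) (hQ : w ∈ Q.gapCone (· < ·)) :
    P = Q := by
  obtain ⟨S, T, hT, hST⟩ := P
  obtain ⟨S', T', hT', hST'⟩ := Q
  obtain ⟨L, hL, hTL⟩ := hP
  obtain ⟨L', hL', hTL'⟩ := hQ
  dsimp only at hL hTL hL' hTL'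
  obtain rfl : S = S' := OrderedPartition.eq_of_le_iff_le fun x y =>
    (hL.le_iff_coordDiff_nonpos hTL.zero_rel).trans
      (hL'.le_iff_coordDiff_nonpos hTL'.zero_rel).symm
  obtain rfl := hL.unique hL'
  obtain rfl := hTL.unique hT hT' hTL'
  rfl

theorem mem_cone_iff_of_collapse {a m : ℕ} (htree : P.tree.CollapseVertex a m Q.tree)
    (hpart : Q.part.blocks = P.part.blocks.take a ++
      ((P.part.blocks.drop a).take m).foldr (· ∪ ·) ∅ :: P.part.blocks.drop (a + m)) :
    w ∈ Q.cone ↔ ∃ L, HasGaps P.part w L ∧ P.tree.MonotoneGaps (· ≤ ·) L ∧ L.getD a 0 = 0 := by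
  have hm := htree.two_le P.branching
  have ham := P.length_eq ▸ htree.add_le_numLeaves
  have hM : ((P.part.blocks.drop a).take m).length = m := by simp; omega
  have hmerge {A B : List ℝ} (hA : A.length = a) : HasGaps Q.part w (A ++ B) ↔
      HasGaps P.part w (A ++ (List.replicate (m - 1) 0 ++ B)) := by
    rw [hasGaps_merge_iff _ (List.ne_nil_of_length_pos (by omega)) hpart (by simp; omega), hM]
    rw [← List.drop_drop, List.take_append_drop, List.take_append_drop]
  rw [cone_eq_gapCone]
  constructor
  · rintro ⟨_, hL, hT⟩
    obtain ⟨A, B, rfl, hA, hT⟩ := htree.monotoneGaps_append_replicate_append hT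
    refine ⟨_, (hmerge hA).1 hL, hT, ?_⟩
    rw [List.getD_append_right _ _ _ _ hA.le, hA, Nat.sub_self,
      List.getD_append _ _ _ _ (by simp; omega)]
    simp
  · rintro ⟨_, hL, hT, h0⟩
    obtain ⟨A, B, hA, rfl, hT'⟩ := htree.exists_eq_append_replicate_append P.branching hT h0
    exact ⟨_, (hmerge hA).2 hL, hT'⟩

theorem Step.exists_cone_eq_sep (h : Step P Q) : ∃ φ : W d →ₗ[ℝ] ℝ,
    (∀ w ∈ P.cone, 0 ≤ φ w) ∧ Q.cone = {w ∈ P.cone | φ w = 0} := by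
  have hcone := P.cone_eq_gapCone
  cases h with
  | contract hpart htree =>
    obtain ⟨i, j, hij⟩ := htree.exists_gaps (α := ℝ) P.branching
    obtain ⟨φ, hφ⟩ := exists_linearMap_eq_getD P.part i
    obtain ⟨ψ, hψ⟩ := exists_linearMap_eq_getD P.part j
    refine ⟨ψ - φ, ?_, Set.ext fun w => ?_⟩
    · rw [hcone]
      rintro w ⟨L, hL, hT⟩
      rw [LinearMap.sub_apply, hφ w L hL, hψ w L hL, sub_nonneg]
      exact ((hij L).1 hT).2.2
    · rw [cone_eq_gapCone, hcone, Set.mem_sep_iff, LinearMap.sub_apply, sub_eq_zero]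
      simp only [gapCone, Set.mem_ofPred_eq, ← hpart, (hij _).2, ← exists_and_right]
      refine exists_congr fun L => ?_
      rw [and_assoc]
      exact and_congr_right fun hL => and_congr_right fun _ => by rw [hφ w L hL, hψ w L hL, eq_comm]
  | collapse a m htree hpart =>
    obtain ⟨φ, hφ⟩ := exists_linearMap_eq_getD P.part a
    refine ⟨φ, ?_, Set.ext fun w => ?_⟩
    · rw [hcone]
      rintro w ⟨L, hL, hT⟩
      have ha := htree.lt_length P.branching hT
      rw [hφ w L hL, List.getD_eq_getElem _ _ ha]
      exact hT.zero_rel _ (List.getElem_mem ha)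
    · rw [mem_cone_iff_of_collapse htree hpart, hcone, Set.mem_sep_iff]
      simp only [gapCone, Set.mem_ofPred_eq, ← exists_and_right]
      refine exists_congr fun L => ?_
      rw [and_assoc]
      exact and_congr_right fun hL => and_congr_right fun _ => by rw [hφ w L hL]

theorem exists_step_of_collapse {a m : ℕ} {T' : PlaneTree}
    (htree : P.tree.CollapseVertex a m T') {L : List ℝ} (hL : HasGaps P.part w L)
    (hT : P.tree.MonotoneGaps (· ≤ ·) L) (ha : L.getD a 0 = 0) :
    ∃ Q, Step P Q ∧ w ∈ Q.cone := by
  have hm := htree.two_le P.branching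
  have ham := P.length_eq ▸ htree.add_le_numLeaves
  obtain ⟨S', hS'⟩ := P.part.exists_merge (A := P.part.blocks.take a)
    (M := (P.part.blocks.drop a).take m) (C := P.part.blocks.drop (a + m))
    (by rw [← List.drop_drop, List.take_append_drop, List.take_append_drop])
    (List.ne_nil_of_length_pos (by simp; omega))
  have hlen : S'.blocks.length = T'.numLeaves := by
    obtain ⟨A, B, hA, rfl, hT'⟩ := htree.exists_eq_append_replicate_append P.branching hT ha
    have hL := hT.length_add_one
    have hL' := hT'.length_add_one
    have hlen := P.length_eq
    simp only [List.length_append, List.length_replicate] at hL hL'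
    simp only [hS', List.length_append, List.length_cons, List.length_take, List.length_drop]
    omega
  exact ⟨⟨S', T', htree.strictlyBranching P.branching, hlen⟩, .collapse a m htree hS',
    (mem_cone_iff_of_collapse htree hS').2 ⟨L, hL, hT, ha⟩⟩

theorem exists_step_of_contract {T' : PlaneTree} (htree : P.tree.ContractEdge T') {L : List ℝ}
    (hL : HasGaps P.part w L) (hT' : T'.MonotoneGaps (· ≤ ·) L) : ∃ Q, Step P Q ∧ w ∈ Q.cone := by
  refine ⟨⟨P.part, T', htree.strictlyBranching P.branching, hL.1.symm.trans hT'.length_add_one⟩,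
    .contract rfl htree, ?_⟩
  rw [cone_eq_gapCone]
  exact ⟨L, hL, hT'⟩

theorem mem_gapCone_lt_or_exists_step (hw : w ∈ P.cone) :
    w ∈ P.gapCone (· < ·) ∨ ∃ Q, Step P Q ∧ w ∈ Q.cone := by
  rw [cone_eq_gapCone] at hw
  obtain ⟨L, hL, hT⟩ := hw
  rcases hT.lt_or_exists P.branching with h | ⟨T', htree, hT'⟩ | ⟨a, m, T', htree, ha⟩
  · exact .inl ⟨L, hL, h⟩
  · exact .inr (exists_step_of_contract htree hL hT')
  · exact .inr (exists_step_of_collapse htree hL hT ha)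

theorem exists_le_mem_gapCone_lt (hw : w ∈ P.cone) : ∃ Q, P ≤ Q ∧ w ∈ Q.gapCone (· < ·) := by
  induction hn : P.tree.numInternal using Nat.strong_induction_on generalizing P with
  | _ n ih =>
    rcases mem_gapCone_lt_or_exists_step hw with hP | ⟨Q, hPQ, hQ⟩
    · exact ⟨P, le_rfl, hP⟩
    · obtain ⟨R, hQR, hR⟩ := ih _ (hn ▸ hPQ.numInternal_lt) hQ rfl
      exact ⟨R, Relation.ReflTransGen.head hPQ hQR, hR⟩

theorem le_of_cone_subset (h : Q.cone ⊆ P.cone) : P ≤ Q := by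
  obtain ⟨w, hw⟩ := Q.gapCone_lt_nonempty
  obtain ⟨R, hPR, hR⟩ := exists_le_mem_gapCone_lt (h (Q.gapCone_lt_subset_cone hw))
  rwa [eq_of_mem_gapCone_lt hw hR]

theorem cone_injective : Function.Injective (cone (d := d)) := fun _ _ h =>
  le_antisymm (le_of_cone_subset h.ge) (le_of_cone_subset h.le)

theorem exists_cone_eq_polyhedron (P : PartitionLabeledTree d) :
    ∃ A : Set (W d →ₗ[ℝ] ℝ), A.Finite ∧ P.cone = polyhedron (fun φ : A => φ.1) 0 := by
  let B : Set (W d →ₗ[ℝ] ℝ) := Set.range fun p : (Fin (d + 1) × Fin (d + 1)) × _ × _ =>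
    coordDiff p.1.1 p.1.2 - coordDiff p.2.1 p.2.2
  obtain ⟨π, hπ⟩ := P.part.exists_refines
  refine ⟨{φ ∈ B | ∀ w ∈ P.cone, 0 ≤ φ w}, (Set.finite_range _).subset (Set.sep_subset _ _),
    Set.Subset.antisymm (fun w hw φ => φ.2.2 w hw) fun w hw => ?_⟩
  have hsub (x y z t : Fin (d + 1)) (h : ∀ v ∈ P.cone, coordDiff z t v ≤ coordDiff x y v) :
      coordDiff z t w ≤ coordDiff x y w :=
    sub_nonneg.1 (hw ⟨_, ⟨((x, y), z, t), rfl⟩, fun v hv => sub_nonneg.2 (h v hv)⟩)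
  have hnonneg (x y : Fin (d + 1)) (h : ∀ v ∈ P.cone, 0 ≤ coordDiff x y v) :
      0 ≤ coordDiff x y w := by
    rw [← coordDiff_self (w := w) x]
    exact hsub x y x x fun v hv => (coordDiff_self x).trans_le (h v hv)
  rw [P.cone_eq hπ] at hsub hnonneg ⊢
  refine ⟨fun x y hxy => le_antisymm ?_ (hnonneg x y fun v hv => (hv.1 x y hxy).ge),
    fun i j hij => hsub _ _ _ _ fun v hv => hv.2.1 i j hij,
    fun l hl => hnonneg _ _ fun v hv => hv.2.2 l hl⟩
  rw [← coordDiff_self (w := w) x]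
  exact hsub x x x y fun v hv => ((hv.1 x y hxy).trans (coordDiff_self x).symm).le

theorem convex_cone (P : PartitionLabeledTree d) : Convex ℝ P.cone := by
  obtain ⟨A, -, hA⟩ := P.exists_cone_eq_polyhedron
  rw [hA]
  exact convex_polyhedron

theorem cone_nonempty (P : PartitionLabeledTree d) : P.cone.Nonempty :=
  P.gapCone_lt_nonempty.mono P.gapCone_lt_subset_cone

theorem isExtreme_cone_of_le (h : P ≤ Q) : IsExtreme ℝ P.cone Q.cone := by
  induction h with
  | refl => exact IsExtreme.rfl
  | tail _ hstep ih =>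
    obtain ⟨φ, hφ, hcone⟩ := hstep.exists_cone_eq_sep
    exact ih.trans (hcone ▸ isExtreme_sep_eq_zero hφ)

theorem isFace_cone_of_le (h : P ≤ Q) : IsFace P.cone Q.cone := by
  have hext := isExtreme_cone_of_le h
  obtain ⟨A, hA, hP⟩ := P.exists_cone_eq_polyhedron
  have := hA.to_subtype
  rw [hP] at hext ⊢
  exact .inr (exists_eq_maximizers_of_isExtreme hext Q.convex_cone Q.cone_nonempty)

theorem le_iff_isFace_cone : P ≤ Q ↔ IsFace P.cone Q.cone := by
  refine ⟨isFace_cone_of_le, fun h => le_of_cone_subset ?_⟩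
  obtain h | ⟨l, h⟩ := h
  · exact absurd h Q.cone_nonempty.ne_empty
  · exact h ▸ Set.sep_subset _ _

end PartitionLabeledTree

end PermutoAssoc

theorem proposition5p6 (d : ℕ) :
    Set.BijOn (fun P : PermutoAssoc.PartitionLabeledTree d => P.cone) Set.univ
      (PermutoAssoc.Xi d) ∧
    ∀ P₁ P₂ : PermutoAssoc.PartitionLabeledTree d,
      (P₁ : PermutoAssoc.KapranovPoset d) ≤ (P₂ : PermutoAssoc.KapranovPoset d) ↔
        PermutoAssoc.IsFace P₁.cone P₂.cone := by
  refine ⟨⟨fun P _ => ⟨P, rfl⟩, PermutoAssoc.PartitionLabeledTree.cone_injective.injOn, ?_⟩,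
    fun P₁ P₂ => ?_⟩
  · rintro _ ⟨P, rfl⟩
    exact ⟨P, trivial, rfl⟩
  · rw [WithBot.coe_le_coe, PermutoAssoc.PartitionLabeledTree.le_iff_isFace_cone]
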